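/- **Setting.** Documents take values in a measurable space $\mathcal{Y}$, and $P_1$, $P_0$ are the population distributions of a document $Y$ in the treatment group ($W=1$) and in the control group ($W=0$). An experiment has units $\{1,\ldots,n\}$ with documents $Y_i$ and group assignments $W_i\in\{0,1\}$; given $W_1,\ldots,W_n$, the $Y_i$ are independent with $Y_i\sim P_{W_i}$. Conditionally on the split (that is, for a fixed split), the units are divided into a hold-out $\mathcal{H}$, containing $h_1$ units with $W_i=1$ and $h_0$ units with $W_i=0$, and the training sample $\mathcal{T}=\{1,\ldots,n\}\setminus\mathcal{H}$. A subset $\mathcal{L}\subseteq\mathcal{H}$ with $\ell_1$ units with $W_i=1$ and $\ell_0$ units with $W_i=0$ ($0<\ell_w\le h_w$) is drawn uniformly at random among all such subsets, given the assignments and independently of the documents; write $L_i=\mathbf{1}\{i\in\mathcal{L}\}$. Themes $\hat f$ and a machine scorer $\hat f^\dagger$ are random (jointly measurable) scoring functions $\mathcal{Y}\to\mathbb{R}^k$ learned from the training data only: $(\hat f,\hat f^\dagger)\perp (Y_i,W_i,L_i)_{i\in\mathcal{H}}\mid (Y_i,W_i)_{i\in\mathcal{T}}$. The true (human) scores are $Y^{\hat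 f}_i=\hat f(Y_i)$ and the machine scores are $\widehat Y^{\hat f}_i=\hat f^\dagger(Y_i)$. Let $$\tau=\mathbb{E}[\hat f(Y)\mid W{=}1,\hat f]-\mathbb{E}[\hat f(Y)\mid W{=}0,\hat f],$$ $$\hat\tau^\dagger=\frac1{h_1}\sum_{i\in\mathcal{H};W_i=1}\widehat Y^{\hat f}_i-\frac1{h_0}\sum_{i\in\mathcal{H};W_i=0}\widehat Y^{\hat f}_i-\Big(\frac1{\ell_1}\sum_{i\in\mathcal{L};W_i=1}(\widehat Y^{\hat f}_i-Y^{\hat f}_i)-\frac1{\ell_0}\sum_{i\in\mathcal{L};W_i=0}(\widehat Y^{\hat f}_i-Y^{\hat f}_i)\Big),$$ where population moments given $W=w$ and $\hat f,\hat f^\dagger$ are those of a fresh document $Y\sim P_w$ with $\hat f,\hat f^\dagger$ held fixed. **Proposition.** Consider a sequence of such experiments, and suppose that there are constants $c<\infty$ and $\varepsilon>0$ such that in all of them, almost surely, all true and machine scores of hold-out units are bounded by $c$ in absolute value, $\mathrm{Var}(\hat f(Y)\mid W{=}1,\hat f)\succeq\varepsilon\mathbb{I}$ and $\mathrm{Var}(\hat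 f^\dagger(Y)-\hat f(Y)\mid W{=}1,\hat f,\hat f^\dagger)\succeq\varepsilon\mathbb{I}$. Then: 1. In each experiment, $\hat\tau^\dagger$ is integrable and $\mathbb{E}[\hat\tau^\dagger\mid\hat f,\hat f^\dagger]=\tau$ almost surely. 2. Suppose in addition that either the same two lower bounds hold for $W=0$ as well, or the ratios $\ell_1/\ell_0$ are bounded along the sequence. If $\underline\ell=\min(\ell_1,\ell_0)\to\infty$, then $$\sup_{t\in\mathbb{R}^k}\Big|\mathbb{P}\big(\sqrt{\underline\ell}\,(\hat\tau^\dagger-\tau)\le t\,\big|\,\hat f,\hat f^\dagger\big)-\mathbb{P}\big(\mathcal{N}(\mathbf{0}_k,\Sigma^\dagger)\le t\,\big|\,\hat f,\hat f^\dagger\big)\Big|\ \stackrel{p}{\longrightarrow}\ 0,$$ with $\le$ componentwise and $$\Sigma^\dagger=\sum_{w\in\{1,0\}}\frac{\underline\ell}{\ell_w}\Big(\frac{\ell_w}{h_w}\mathrm{Var}(\hat f(Y)\mid W{=}w,\hat f)+\Big(1-\frac{\ell_w}{h_w}\Big)\mathrm{Var}(\hat f^\dagger(Y)-\hat f(Y)\mid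 W{=}w,\hat f,\hat f^\dagger)\Big).$$ -/

import Mathlib

open MeasureTheory ProbabilityTheory Filter Topology
open scoped Matrix

/-- Conditional independence of the random elements `X` and `Z` given a sub-σ-algebra `m`:
`P(X ∈ A, Z ∈ B | m) = P(X ∈ A | m) P(Z ∈ B | m)` a.s. for all measurable `A`, `B`.
(Mathlib's `CondIndepFun` is the same notion, but only for a standard Borel sample space; see
`condIndepRV_iff_condIndepFun`.) -/
def CondIndepRV {Ω α β : Type*} [MeasurableSpace α] [MeasurableSpace β]
    (m : MeasurableSpace Ω) [MeasurableSpace Ω] (X : Ω → α) (Z : Ω → β) (μ : Measure Ω) : Prop :=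
  ∀ (A : Set α) (B : Set β), MeasurableSet A → MeasurableSet B →
    μ⟦X ⁻¹' A ∩ Z ⁻¹' B | m⟧ =ᵐ[μ]
      fun ω => (μ⟦X ⁻¹' A | m⟧) ω * (μ⟦Z ⁻¹' B | m⟧) ω

theorem condIndepRV_iff_condIndepFun {Ω α β : Type*} [MeasurableSpace α] [MeasurableSpace β]
    (m : MeasurableSpace Ω) [mΩ : MeasurableSpace Ω] [StandardBorelSpace Ω] (hm : m ≤ mΩ)
    (X : Ω → α) (Z : Ω → β) (hX : Measurable X) (hZ : Measurable Z)
    (μ : Measure Ω) [IsFiniteMeasure μ] :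
    CondIndepRV m X Z μ ↔ CondIndepFun m hm X Z μ := by
  rw [condIndepFun_iff_condExp_inter_preimage_eq_mul hX hZ]
  exact ⟨fun h s t hs ht => h s t hs ht, fun h s t hs ht => h s t hs ht⟩

/-- Mean vector of the scores `s(Y)` for a document `Y` drawn from `Q`. -/
noncomputable def scoreMean {𝒴 : Type*} [MeasurableSpace 𝒴] {k : ℕ}
    (Q : Measure 𝒴) (s : 𝒴 → Fin k → ℝ) : Fin k → ℝ :=
  fun j => ∫ y, s y j ∂Q

/-- Covariance matrix of the scores `s(Y)` for a document `Y` drawn from `Q`. -/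
noncomputable def scoreVar {𝒴 : Type*} [MeasurableSpace 𝒴] {k : ℕ}
    (Q : Measure 𝒴) (s : 𝒴 → Fin k → ℝ) : Matrix (Fin k) (Fin k) ℝ :=
  Matrix.of fun a b => cov[fun y => s y a, fun y => s y b; Q]

/-- The data of one experiment on the sample space `Ω`. Groups are coded by `Bool`:
`true` is treatment (`W = 1`), `false` is control (`W = 0`). Themes are elements of a measurable
space `Θ` and machine scorers are elements of a measurable space `Ψ`; how they score documents
is given separately. The split into hold-out and training (the complement of `holdOut`)
is conditioned upon, hence not random. -/
structure HoldOutStudy (Ω 𝒴 Θ Ψ : Type*) where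
  /-- number of observations -/
  n : ℕ
  /-- the hold-out sample -/
  holdOut : Finset (Fin n)
  /-- number of hold-out units in each group -/
  h : Bool → ℕ
  /-- number of hold-out units in each group that receive true (human) scores -/
  l : Bool → ℕ
  /-- the documents -/
  Y : Ω → Fin n → 𝒴
  /-- the group assignments -/
  W : Ω → Fin n → Bool
  /-- indicator of the labeled subset -/
  L : Ω → Fin n → Bool
  /-- the learned themes -/
  themes : Ω → Θ
  /-- the learned machine scorer -/
  scorer : Ω → Ψ

namespace HoldOutStudy

variable {Ω 𝒴 Θ Ψ : Type*} {k : ℕ}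

/-- `(Yᵢ, Wᵢ)` for `i` in the training sample. -/
def trainingData (S : HoldOutStudy Ω 𝒴 Θ Ψ) (ω : Ω) : {i // i ∉ S.holdOut} → 𝒴 × Bool :=
  fun i => (S.Y ω i, S.W ω i)

/-- `(Yᵢ, Wᵢ, Lᵢ)` for `i` in the hold-out sample. -/
def holdOutData (S : HoldOutStudy Ω 𝒴 Θ Ψ) (ω : Ω) : {i // i ∈ S.holdOut} → 𝒴 × Bool × Bool :=
  fun i => (S.Y ω i, S.W ω i, S.L ω i)

/-- The (indicators of the) subsets of the hold-out that contain exactly `l v` units of each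
group `v`, when the group assignment is `w`. -/
def labelSets (S : HoldOutStudy Ω 𝒴 Θ Ψ) (w : Fin S.n → Bool) : Set (Fin S.n → Bool) :=
  {s | (∀ i, s i = true → i ∈ S.holdOut) ∧
    ∀ v : Bool, (Finset.univ.filter fun i => s i = true ∧ w i = v).card = S.l v}

/-- The sampling, splitting, labeling and learning assumptions, where `P w` is the population
distribution of documents in group `w`. -/
structure IsSampled [MeasurableSpace Ω] [MeasurableSpace 𝒴] [MeasurableSpace Θ]
    [MeasurableSpace Ψ] (S : HoldOutStudy Ω 𝒴 Θ Ψ) (μ : Measure Ω) (P : Bool → Measure 𝒴) :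
    Prop where
  measurable_Y : Measurable S.Y
  measurable_W : Measurable S.W
  measurable_L : Measurable S.L
  measurable_themes : Measurable S.themes
  measurable_scorer : Measurable S.scorer
  /-- the hold-out has `h w` units in group `w` -/
  card_holdOut : ∀ᵐ ω ∂μ, ∀ w : Bool, (S.holdOut.filter fun i => S.W ω i = w).card = S.h w
  label_pos : ∀ w, 0 < S.l w
  label_le : ∀ w, S.l w ≤ S.h w
  /-- given the group assignment, the documents are independent draws from the population
  distributions of their groups, and the labeled subset is drawn, independently of the documents,
  uniformly among the subsets of the hold-out with the prescribed numbers of units per group -/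
  law : ∀ w : Fin S.n → Bool, μ (S.W ⁻¹' {w}) ≠ 0 →
    (cond μ (S.W ⁻¹' {w})).map (fun ω => (S.Y ω, S.L ω)) =
      (Measure.pi fun i => P (w i)).prod (uniformOn (S.labelSets w))
  /-- themes and machine scorer are learned from the training data only -/
  condIndep : CondIndepRV (MeasurableSpace.comap S.trainingData inferInstance)
    (fun ω => (S.themes ω, S.scorer ω)) S.holdOutData μ

/-- The true score vector of unit `i`. -/
def trueScore (S : HoldOutStudy Ω 𝒴 Θ Ψ) (f : Θ → 𝒴 → Fin k → ℝ) (i : Fin S.n) (ω : Ω) :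
    Fin k → ℝ :=
  f (S.themes ω) (S.Y ω i)

/-- The machine score vector of unit `i`. -/
def machineScore (S : HoldOutStudy Ω 𝒴 Θ Ψ) (g : Ψ → 𝒴 → Fin k → ℝ) (i : Fin S.n) (ω : Ω) :
    Fin k → ℝ :=
  g (S.scorer ω) (S.Y ω i)

/-- The estimand `E[f̂(Y) | W = 1, f̂] - E[f̂(Y) | W = 0, f̂]`. -/
noncomputable def tau [MeasurableSpace 𝒴] (S : HoldOutStudy Ω 𝒴 Θ Ψ) (P : Bool → Measure 𝒴)
    (f : Θ → 𝒴 → Fin k → ℝ) (ω : Ω) : Fin k → ℝ :=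
  scoreMean (P true) (f (S.themes ω)) - scoreMean (P false) (f (S.themes ω))

/-- Average machine score of the hold-out units in group `w`. -/
noncomputable def machineMean (S : HoldOutStudy Ω 𝒴 Θ Ψ) (g : Ψ → 𝒴 → Fin k → ℝ) (w : Bool)
    (ω : Ω) : Fin k → ℝ :=
  (1 / (S.h w : ℝ)) • ∑ i ∈ S.holdOut.filter (fun i => S.W ω i = w), S.machineScore g i ω

/-- Average difference of machine and true scores of the labeled units in group `w`. -/
noncomputable def errorMean (S : HoldOutStudy Ω 𝒴 Θ Ψ) (f : Θ → 𝒴 → Fin k → ℝ)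
    (g : Ψ → 𝒴 → Fin k → ℝ) (w : Bool) (ω : Ω) : Fin k → ℝ :=
  (1 / (S.l w : ℝ)) • ∑ i ∈ S.holdOut.filter (fun i => S.L ω i = true ∧ S.W ω i = w),
    (S.machineScore g i ω - S.trueScore f i ω)

/-- The combined (prediction-powered) estimator. -/
noncomputable def tauHat (S : HoldOutStudy Ω 𝒴 Θ Ψ) (f : Θ → 𝒴 → Fin k → ℝ)
    (g : Ψ → 𝒴 → Fin k → ℝ) (ω : Ω) : Fin k → ℝ :=
  S.machineMean g true ω - S.machineMean g false ω
    - (S.errorMean f g true ω - S.errorMean f g false ω)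

/-- The smaller of the two numbers of labeled units. -/
def lmin (S : HoldOutStudy Ω 𝒴 Θ Ψ) : ℕ := min (S.l true) (S.l false)

/-- The within-group variance of the true scores, `Var(f̂(Y) | W = w, f̂)`. -/
noncomputable def varTrue [MeasurableSpace 𝒴] (S : HoldOutStudy Ω 𝒴 Θ Ψ) (P : Bool → Measure 𝒴)
    (f : Θ → 𝒴 → Fin k → ℝ) (w : Bool) (ω : Ω) : Matrix (Fin k) (Fin k) ℝ :=
  scoreVar (P w) (f (S.themes ω))

/-- The within-group variance of the score errors, `Var(f̂†(Y) - f̂(Y) | W = w, f̂, f̂†)`. -/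
noncomputable def varError [MeasurableSpace 𝒴] (S : HoldOutStudy Ω 𝒴 Θ Ψ)
    (P : Bool → Measure 𝒴) (f : Θ → 𝒴 → Fin k → ℝ) (g : Ψ → 𝒴 → Fin k → ℝ) (w : Bool) (ω : Ω) :
    Matrix (Fin k) (Fin k) ℝ :=
  scoreVar (P w) (fun y => g (S.scorer ω) y - f (S.themes ω) y)

/-- Almost surely, `ε I ⪯ Var(f̂(Y) | W = w, f̂)` and `ε I ⪯ Var(f̂†(Y) - f̂(Y) | W = w, f̂, f̂†)`. -/
def VarBoundedBelow [MeasurableSpace Ω] [MeasurableSpace 𝒴] (S : HoldOutStudy Ω 𝒴 Θ Ψ)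
    (μ : Measure Ω) (P : Bool → Measure 𝒴) (f : Θ → 𝒴 → Fin k → ℝ) (g : Ψ → 𝒴 → Fin k → ℝ)
    (ε : ℝ) (w : Bool) : Prop :=
  ∀ᵐ ω ∂μ, (S.varTrue P f w ω - ε • (1 : Matrix (Fin k) (Fin k) ℝ)).PosSemidef ∧
    (S.varError P f g w ω - ε • (1 : Matrix (Fin k) (Fin k) ℝ)).PosSemidef

/-- The variance contribution of group `w`:
`(l_w / h_w) Var(f̂(Y) | W = w, f̂) + (1 - l_w / h_w) Var(f̂†(Y) - f̂(Y) | W = w, f̂, f̂†)`. -/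
noncomputable def groupVar [MeasurableSpace 𝒴] (S : HoldOutStudy Ω 𝒴 Θ Ψ)
    (P : Bool → Measure 𝒴) (f : Θ → 𝒴 → Fin k → ℝ) (g : Ψ → 𝒴 → Fin k → ℝ) (w : Bool) (ω : Ω) :
    Matrix (Fin k) (Fin k) ℝ :=
  ((S.l w : ℝ) / (S.h w : ℝ)) • S.varTrue P f w ω
    + (1 - (S.l w : ℝ) / (S.h w : ℝ)) • S.varError P f g w ω

/-- The asymptotic variance `Σ†` (a function of the learned themes and scorer). -/
noncomputable def sigma [MeasurableSpace 𝒴] (S : HoldOutStudy Ω 𝒴 Θ Ψ)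
    (P : Bool → Measure 𝒴) (f : Θ → 𝒴 → Fin k → ℝ) (g : Ψ → 𝒴 → Fin k → ℝ) (ω : Ω) :
    Matrix (Fin k) (Fin k) ℝ :=
  ((S.lmin : ℝ) / (S.l true : ℝ)) • S.groupVar P f g true ω
    + ((S.lmin : ℝ) / (S.l false : ℝ)) • S.groupVar P f g false ω

/-- The pair of learned objects that everything is conditioned on. -/
def learned (S : HoldOutStudy Ω 𝒴 Θ Ψ) (ω : Ω) : Θ × Ψ := (S.themes ω, S.scorer ω)

/-- The scaled estimation error `√l_min (τ̂† - τ)`. -/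
noncomputable def scaledError [MeasurableSpace 𝒴] (S : HoldOutStudy Ω 𝒴 Θ Ψ)
    (P : Bool → Measure 𝒴) (f : Θ → 𝒴 → Fin k → ℝ) (g : Ψ → 𝒴 → Fin k → ℝ) (ω : Ω) : Fin k → ℝ :=
  Real.sqrt (S.lmin : ℝ) • (S.tauHat f g ω - S.tau P f ω)

/-- The (random) sup-distance over `t ∈ ℝᵏ` between the conditional distribution function of the
scaled error given `(f̂, f̂†)` and the distribution function of `N(0, Σ†)`, both with respect to
the componentwise order. -/
noncomputable def cdfGap [MeasurableSpace Ω] [MeasurableSpace 𝒴] [MeasurableSpace Θ]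
    [MeasurableSpace Ψ] (S : HoldOutStudy Ω 𝒴 Θ Ψ) (μ : Measure Ω) [IsFiniteMeasure μ]
    (P : Bool → Measure 𝒴) (f : Θ → 𝒴 → Fin k → ℝ) (g : Ψ → 𝒴 → Fin k → ℝ) (ω : Ω) : ℝ :=
  ⨆ t : Fin k → ℝ,
    |(condDistrib (S.scaledError P f g) S.learned μ (S.learned ω)).real {x | ∀ j, x j ≤ t j}
      - (multivariateGaussian 0 (S.sigma P f g ω)).real {x | ∀ j, x j ≤ t j}|

end HoldOutStudy

/-!
Fix the learned themes and scorer, that is, fix the score functions `f̂` and `f̂†`. The estimator is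
then a sum over the hold-out units of a `contribution` that depends on the unit's document, group
and label only, and whose terms are `O(1 / l_w)`.

*Conditioning.* The learned objects depend on the hold-out data only through the training data, and
given the group assignment the hold-out documents are independent of the training data and of the
labels. Hence, on the event that the hold-out units have given groups and labels, the learned
objects are independent of the hold-out documents, which have a product law
(`IsSampled.map_learned_docs`). The law of the error for fixed score functions depends on groups
and labels only through the group sizes, because its characteristic function is a product over the
units (`errorLaw_eq_of_isPattern`). These sizes are not random, so this law is the conditional law of
the error given the learned objects (`IsSampled.condDistrib_scaledError`); uniformity of the
labeling is not needed beyond the fact that it respects the group sizes.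

*Unbiasedness* follows, since the contributions have expectations that sum to `τ` for fixed score
functions (`sum_integral_contribution`).

*Normality.* The variances of the contributions, scaled by the smaller number `l` of labeled
units, add up to `Σ†`, by an identity for the variances of labeled and unlabeled terms
(`labeled_add_unlabeled_variance`). As the scaled contributions are bounded by a multiple of
`1 / √l`, Lindeberg's argument puts the characteristic function of the error within `O(1 / √l)` of
that of `N(0, Σ†)`, with a constant that depends on the argument and on the bound `c` only
(`norm_charFun_errorLaw_sub_le`). The entries of `Σ†` are bounded and its diagonal is bounded away
from zero, so a compactness argument with Lévy's theorem and the portmanteau theorem turns this into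
uniform closeness of the distribution functions (`exists_charFun_close_imp_orthant_close`). The
resulting bound on the gap is deterministic: it holds almost surely as soon as `l` is large
(`HoldOutStudy.exists_cdfGap_le`), which is more than convergence in probability.
-/

/-! ### Uniform convergence of distribution functions over orthants -/

/-- The coordinatewise arctangent. It is an order embedding of `ℝᵏ` into a compact cube, so that
thresholds that escape to infinity still have limit points. -/
noncomputable def arctanMap {ι : Type*} (x : EuclideanSpace ℝ ι) : EuclideanSpace ℝ ι :=
  WithLp.toLp 2 fun j => Real.arctan (x j)

theorem continuous_arctanMap {ι : Type*} [Fintype ι] :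
    Continuous (arctanMap : EuclideanSpace ℝ ι → EuclideanSpace ℝ ι) := by
  unfold arctanMap
  refine (PiLp.continuous_toLp 2 _).comp (continuous_pi fun j => ?_)
  exact Real.continuous_arctan.comp (by fun_prop)

theorem frontier_nonpos_subset {ι : Type*} [Fintype ι] :
    frontier {x : EuclideanSpace ℝ ι | ∀ j, x j ≤ 0} ⊆ ⋃ j, {x | x j = 0} := by
  have hclosed : IsClosed {x : EuclideanSpace ℝ ι | ∀ j, x j ≤ 0} := by
    simp only [Set.ofPred_forall]
    exact isClosed_iInter fun j => isClosed_le (by fun_prop) continuous_const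
  have hopen : IsOpen {x : EuclideanSpace ℝ ι | ∀ j, x j < 0} := by
    simp only [Set.ofPred_forall]
    exact isOpen_iInter_of_finite fun j => isOpen_lt (by fun_prop) continuous_const
  have hsub : {x : EuclideanSpace ℝ ι | ∀ j, x j < 0} ⊆
      interior {x : EuclideanSpace ℝ ι | ∀ j, x j ≤ 0} :=
    interior_maximal (fun x hx j => (hx j).le) hopen
  intro x hx
  rw [frontier, hclosed.closure_eq] at hx
  by_contra hcon
  simp only [Set.mem_iUnion, Set.mem_ofPred_eq, not_exists] at hcon
  exact hx.2 (hsub fun j => lt_of_le_of_ne (hx.1 j) (hcon j))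

/-- Weak convergence `νₙ ⇒ ν` and `sₙ → s` give weak convergence of the measures translated by `sₙ`
to the translate of `ν` by `s`. -/
theorem tendsto_map_add_of_tendsto {E : Type*} [NormedAddCommGroup E] [InnerProductSpace ℝ E]
    [FiniteDimensional ℝ E] [MeasurableSpace E] [BorelSpace E]
    {ν : ℕ → ProbabilityMeasure E} {ν' : ProbabilityMeasure E} (hν : Tendsto ν atTop (𝓝 ν'))
    {s : ℕ → E} {s' : E} (hs : Tendsto s atTop (𝓝 s')) :
    Tendsto (fun n => (ν n).map (f := fun x => x + s n) (by fun_prop)) atTop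
      (𝓝 (ν'.map (f := fun x => x + s') (by fun_prop))) := by
  apply ProbabilityMeasure.tendsto_of_tendsto_charFun
  intro u
  have h1 := ProbabilityMeasure.tendsto_iff_tendsto_charFun.1 hν u
  have h2 : Tendsto (fun n => Complex.exp (((inner ℝ (s n) u : ℝ) : ℂ) * Complex.I)) atTop
      (𝓝 (Complex.exp (((inner ℝ s' u : ℝ) : ℂ) * Complex.I))) := by
    have hc : Continuous fun z : E => Complex.exp (((inner ℝ z u : ℝ) : ℂ) * Complex.I) := by
      fun_prop
    exact (hc.tendsto s').comp hs
  simpa only [ProbabilityMeasure.toMeasure_map, charFun_map_add_const] using h1.mul h2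

/-- Weak convergence to a law without mass on coordinate hyperplanes gives convergence of the
probabilities of lower orthants, even when the thresholds move and some of them diverge: only
their arctangents need to converge. -/
theorem tendsto_orthant_of_tendsto {ι : Type*} [Fintype ι]
    {ν : ℕ → ProbabilityMeasure (EuclideanSpace ℝ ι)} {ν' : ProbabilityMeasure (EuclideanSpace ℝ ι)}
    (hν : Tendsto ν atTop (𝓝 ν'))
    (hatom : ∀ j a, (ν' : Measure (EuclideanSpace ℝ ι)) {x | x j = a} = 0)
    {t : ℕ → ι → ℝ} {b : ι → ℝ}
    (ht : Tendsto (fun n j => Real.arctan (t n j)) atTop (𝓝 b)) :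
    Tendsto (fun n => (ν n : Measure (EuclideanSpace ℝ ι)).real {x | ∀ j, x j ≤ t n j}) atTop
      (𝓝 ((ν' : Measure (EuclideanSpace ℝ ι)).real {x | ∀ j, Real.arctan (x j) ≤ b j})) := by
  have h1 := ProbabilityMeasure.tendsto_map_of_tendsto_of_continuous ν ν' hν
    (continuous_arctanMap (ι := ι))
  have hs : Tendsto (fun n => -(WithLp.toLp 2 fun j => Real.arctan (t n j) : EuclideanSpace ℝ ι))
      atTop (𝓝 (-WithLp.toLp 2 b)) :=
    (((PiLp.continuous_toLp 2 _).tendsto b).comp ht).neg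
  have h2 := tendsto_map_add_of_tendsto h1 hs
  have hmeas : MeasurableSet {x : EuclideanSpace ℝ ι | ∀ j, x j ≤ 0} := by
    simp only [Set.ofPred_forall]
    exact MeasurableSet.iInter fun j => measurableSet_le (by fun_prop) measurable_const
  have hm : Measurable (arctanMap : EuclideanSpace ℝ ι → EuclideanSpace ℝ ι) :=
    continuous_arctanMap.measurable
  have hfront : (((ν'.map hm.aemeasurable).map
      (f := fun x => x + -WithLp.toLp 2 b) (by fun_prop) : ProbabilityMeasure _) :
        Measure (EuclideanSpace ℝ ι)) (frontier {x | ∀ j, x j ≤ 0}) = 0 := by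
    refine measure_mono_null frontier_nonpos_subset ?_
    rw [measure_iUnion_null_iff]
    intro j
    have hmj : MeasurableSet {x : EuclideanSpace ℝ ι | x j = 0} :=
      measurableSet_eq_fun (by fun_prop) measurable_const
    rw [ProbabilityMeasure.toMeasure_map, ProbabilityMeasure.toMeasure_map,
      Measure.map_map (by fun_prop) hm, Measure.map_apply (by fun_prop) hmj]
    refine measure_mono_null (fun x hx => ?_) (hatom j (Real.tan (b j)))
    have hx' : Real.arctan (x j) + -b j = 0 := hx
    have : Real.arctan (x j) = b j := by linarith
    change x j = Real.tan (b j)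
    rw [← this, Real.tan_arctan]
  have h3 := ProbabilityMeasure.tendsto_measure_of_null_frontier_of_tendsto' h2 hfront
  have h4 := (ENNReal.tendsto_toReal (measure_ne_top _ _)).comp h3
  have key : ∀ (ρ : ProbabilityMeasure (EuclideanSpace ℝ ι)) (z : ι → ℝ),
      (((ρ.map hm.aemeasurable).map
        (f := fun x => x + -WithLp.toLp 2 z) (by fun_prop) : ProbabilityMeasure _) :
        Measure (EuclideanSpace ℝ ι)) {x | ∀ j, x j ≤ 0} =
      (ρ : Measure (EuclideanSpace ℝ ι)) {x | ∀ j, Real.arctan (x j) ≤ z j} := by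
    intro ρ z
    rw [ProbabilityMeasure.toMeasure_map, ProbabilityMeasure.toMeasure_map,
      Measure.map_map (by fun_prop) hm, Measure.map_apply (by fun_prop) hmeas]
    congr 1
    ext x
    change (∀ j, Real.arctan (x j) + -z j ≤ 0) ↔ ∀ j, Real.arctan (x j) ≤ z j
    simp [← sub_eq_add_neg]
  rw [Measure.real, ← key]
  refine h4.congr fun n => ?_
  simp only [Function.comp_apply]
  rw [key]
  simp [Measure.real, Real.arctan_le_arctan_iff]

/-- A compactness form of the central limit theorem: if the characteristic function of a law `Q`
is pointwise close to that of a centred Gaussian law whose covariance matrix has bounded entries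
and diagonal bounded away from zero, then the distribution functions of the two laws are
uniformly close. The modulus `η` depends only on the bounds. -/
theorem exists_charFun_close_imp_orthant_close {ι : Type*} [Fintype ι] [DecidableEq ι]
    (B e δ : ℝ) (he : 0 < e) (hδ : 0 < δ) (K : EuclideanSpace ℝ ι → ℝ) :
    ∃ η : ℝ, 0 < η ∧ ∀ (Q : Measure (EuclideanSpace ℝ ι)) (_ : IsProbabilityMeasure Q)
      (A : Matrix ι ι ℝ), A.PosSemidef → (∀ i j, |A i j| ≤ B) → (∀ i, e ≤ A i i) →
      (∀ u : EuclideanSpace ℝ ι,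
        ‖charFun Q u - Complex.exp (-((u.ofLp ⬝ᵥ A *ᵥ u.ofLp : ℝ) : ℂ) / 2)‖ ≤ K u * η) →
      ∀ t : ι → ℝ, |Q.real {x | ∀ j, x j ≤ t j}
        - (multivariateGaussian 0 A).real {x | ∀ j, x j ≤ t j}| ≤ δ := by
  by_contra! hcon
  choose Q hQ A hpsd hB hdiag hchar t ht using
    fun n : ℕ => hcon (1 / ((n : ℝ) + 1)) (by positivity)
  -- The matrices and the arctangents of the thresholds live in compact sets.
  let S1 : Set ((ι → ι → ℝ) × (ι → ℝ)) :=
    Metric.closedBall 0 (max B 0) ×ˢ Metric.closedBall 0 (Real.pi / 2)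
  have hS1 : IsCompact S1 := (isCompact_closedBall _ _).prod (isCompact_closedBall _ _)
  have hmem : ∀ n, ((fun i j => A n i j, fun j => Real.arctan (t n j)) :
      (ι → ι → ℝ) × (ι → ℝ)) ∈ S1 := by
    intro n
    refine ⟨?_, ?_⟩
    · rw [mem_closedBall_zero_iff]
      refine (pi_norm_le_iff_of_nonneg (le_max_right _ _)).2 fun i =>
        (pi_norm_le_iff_of_nonneg (le_max_right _ _)).2 fun j => ?_
      exact (hB n i j).trans (le_max_left _ _)
    · rw [mem_closedBall_zero_iff]
      refine (pi_norm_le_iff_of_nonneg (by positivity)).2 fun j => ?_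
      exact abs_le.2 ⟨(Real.neg_pi_div_two_lt_arctan _).le, (Real.arctan_lt_pi_div_two _).le⟩
  obtain ⟨⟨A', b⟩, -, φ, hφ, hlim⟩ := hS1.tendsto_subseq hmem
  rw [Prod.tendsto_iff] at hlim
  obtain ⟨hlimA, hlimt⟩ := hlim
  have hAij : ∀ i j, Tendsto (fun n => A (φ n) i j) atTop (𝓝 (A' i j)) := fun i j =>
    tendsto_pi_nhds.1 (tendsto_pi_nhds.1 hlimA i) j
  have hquad : ∀ x : ι → ℝ, Tendsto (fun n => x ⬝ᵥ A (φ n) *ᵥ x) atTop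
      (𝓝 (x ⬝ᵥ Matrix.of A' *ᵥ x)) := by
    intro x
    simp only [dotProduct, Matrix.mulVec]
    exact tendsto_finsetSum _ fun i _ => tendsto_const_nhds.mul
      (tendsto_finsetSum _ fun j _ => (hAij i j).mul tendsto_const_nhds)
  have hpsd' : (Matrix.of A').PosSemidef := by
    refine Matrix.PosSemidef.of_dotProduct_mulVec_nonneg ?_ fun x => ?_
    · ext i j
      have h1 := hAij j i
      have h2 := hAij i j
      refine tendsto_nhds_unique (h1.congr fun n => ?_) h2
      have := (hpsd (φ n)).isHermitian.apply i j
      simpa using this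
    · exact ge_of_tendsto' (hquad x) fun n => (hpsd (φ n)).dotProduct_mulVec_nonneg x
  have hdiag' : ∀ i, e ≤ A' i i := fun i => ge_of_tendsto' (hAij i i) fun n => hdiag _ i
  have hexp : ∀ u : EuclideanSpace ℝ ι,
      Tendsto (fun n => Complex.exp (-((u.ofLp ⬝ᵥ A (φ n) *ᵥ u.ofLp : ℝ) : ℂ) / 2)) atTop
        (𝓝 (Complex.exp (-((u.ofLp ⬝ᵥ Matrix.of A' *ᵥ u.ofLp : ℝ) : ℂ) / 2))) := by
    intro u
    have hc : Continuous fun z : ℝ => Complex.exp (-(z : ℂ) / 2) := by fun_prop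
    exact (hc.tendsto _).comp (hquad u.ofLp)
  have hgchar : ∀ (M : Matrix ι ι ℝ), M.PosSemidef → ∀ u : EuclideanSpace ℝ ι,
      charFun (multivariateGaussian 0 M) u =
        Complex.exp (-((u.ofLp ⬝ᵥ M *ᵥ u.ofLp : ℝ) : ℂ) / 2) := by
    intro M hM u
    rw [charFun_multivariateGaussian hM]
    simp [neg_div]
  let G' : ProbabilityMeasure (EuclideanSpace ℝ ι) :=
    ⟨multivariateGaussian 0 (Matrix.of A'), inferInstance⟩
  have hG : Tendsto (β := ProbabilityMeasure (EuclideanSpace ℝ ι))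
      (fun n => ⟨multivariateGaussian 0 (A (φ n)), inferInstance⟩) atTop (𝓝 G') := by
    apply ProbabilityMeasure.tendsto_of_tendsto_charFun
    intro u
    simp only [G', ProbabilityMeasure.coe_mk]
    rw [hgchar _ hpsd']
    exact (hexp u).congr fun n => (hgchar _ (hpsd _) u).symm
  have hQlim : Tendsto (β := ProbabilityMeasure (EuclideanSpace ℝ ι))
      (fun n => ⟨Q (φ n), hQ (φ n)⟩) atTop (𝓝 G') := by
    apply ProbabilityMeasure.tendsto_of_tendsto_charFun
    intro u
    simp only [G', ProbabilityMeasure.coe_mk]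
    rw [hgchar _ hpsd']
    have h0 : Tendsto (fun n => K u * (1 / ((φ n : ℝ) + 1))) atTop (𝓝 0) := by
      have := (tendsto_one_div_add_atTop_nhds_zero_nat (𝕜 := ℝ)).comp hφ.tendsto_atTop
      simpa using this.const_mul (K u)
    have h1 := squeeze_zero_norm (fun n => hchar (φ n) u) h0
    simpa using h1.add (hexp u)
  have hatom : ∀ j a, (G' : Measure (EuclideanSpace ℝ ι)) {x | x j = a} = 0 := by
    intro j a
    have hmp := measurePreserving_eval_multivariateGaussian (μ := 0) hpsd' (i := j)
    have hne : (Matrix.of A' j j).toNNReal ≠ 0 := by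
      have : 0 < A' j j := he.trans_le (hdiag' j)
      simpa using this
    have := nullSingletonClass_gaussianReal (μ := (0 : EuclideanSpace ℝ ι) j) hne
    have h2 := hmp.measure_preimage (measurableSet_singleton a).nullMeasurableSet
    rw [measure_singleton] at h2
    exact h2
  have hl1 := tendsto_orthant_of_tendsto hQlim hatom hlimt
  have hl2 := tendsto_orthant_of_tendsto hG hatom hlimt
  have hdiff := (hl1.sub hl2).abs
  simp only [ProbabilityMeasure.coe_mk, sub_self, abs_zero] at hdiff
  exact absurd (ge_of_tendsto' hdiff fun n => (ht (φ n)).le) (not_le.2 hδ)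

/-! ### Characteristic functions of sums of small independent terms -/

theorem norm_cexp_sub_taylor_le (x : ℝ) :
    ‖Complex.exp (x * Complex.I) - (1 + x * Complex.I - (x : ℂ) ^ 2 / 2)‖ ≤ 4 * |x| ^ 3 := by
  have hnx : ‖(x : ℂ) * Complex.I‖ = |x| := by simp
  rcases le_or_gt |x| 1 with hx | hx
  · have h := Complex.exp_bound (x := x * Complex.I) (by rw [hnx]; exact hx) (n := 3) (by norm_num)
    rw [hnx] at h
    have hs : ∑ m ∈ Finset.range 3, ((x : ℂ) * Complex.I) ^ m / (m.factorial : ℂ) =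
        1 + x * Complex.I - (x : ℂ) ^ 2 / 2 := by
      simp [Finset.sum_range_succ, mul_pow, Nat.factorial]
      ring
    rw [hs] at h
    refine h.trans ?_
    have : 0 ≤ |x| ^ 3 := by positivity
    norm_num [Nat.factorial]
    linarith
  · have h1 : ‖Complex.exp (x * Complex.I)‖ = 1 := Complex.norm_exp_ofReal_mul_I x
    have h2 : ‖(1 + x * Complex.I - (x : ℂ) ^ 2 / 2)‖ ≤ 1 + |x| + |x| ^ 2 / 2 := by
      refine (norm_sub_le _ _).trans (add_le_add ((norm_add_le _ _).trans ?_) ?_)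
      · simp
      · simp
    refine (norm_sub_le _ _).trans ?_
    rw [h1]
    have h3 : |x| ^ 2 ≤ |x| ^ 3 := pow_le_pow_right₀ hx.le (by norm_num)
    have h4 : |x| ≤ |x| ^ 2 := by nlinarith
    linarith

/-- The characteristic function of a bounded centred variable agrees with that of the normal law
of the same variance, up to an error of third order. -/
theorem norm_integral_cexp_sub_exp_le {α : Type*} [MeasurableSpace α] (m : Measure α)
    [IsProbabilityMeasure m] {X : α → ℝ} (hX : Measurable X) {M : ℝ} (hM : ∀ᵐ y ∂m, |X y| ≤ M)
    (h0 : ∫ y, X y ∂m = 0) :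
    ‖∫ y, Complex.exp (X y * Complex.I) ∂m - Complex.exp (-((∫ y, X y ^ 2 ∂m : ℝ) : ℂ) / 2)‖
      ≤ 5 * M * ∫ y, X y ^ 2 ∂m := by
  set v := ∫ y, X y ^ 2 ∂m with hv
  have hM0 : 0 ≤ M := by
    obtain ⟨y, hy⟩ := hM.exists
    exact (abs_nonneg _).trans hy
  have hv0 : 0 ≤ v := integral_nonneg fun y => sq_nonneg _
  have hXi : Integrable X m := Integrable.of_bound hX.aestronglyMeasurable M hM
  have hX2i : Integrable (fun y => X y ^ 2) m := by
    refine Integrable.of_bound (hX.pow_const 2).aestronglyMeasurable (M ^ 2) ?_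
    filter_upwards [hM] with y hy
    rw [norm_pow]
    exact pow_le_pow_left₀ (norm_nonneg _) hy 2
  have hvM : v ≤ M ^ 2 := by
    have h := integral_mono_ae hX2i (integrable_const (M ^ 2))
      (by filter_upwards [hM] with y hy; exact sq_le_sq' (by linarith [abs_le.1 hy]) (abs_le.1 hy).2)
    simpa using h
  have hei : Integrable (fun y => Complex.exp (X y * Complex.I)) m := by
    refine Integrable.of_bound (by fun_prop) 1 (ae_of_all _ fun y => ?_)
    rw [Complex.norm_exp_ofReal_mul_I]
  have hti : Integrable (fun y => 1 + X y * Complex.I - (X y : ℂ) ^ 2 / 2) m := by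
    refine ((integrable_const _).add (hXi.ofReal.mul_const _)).sub ?_
    have := hX2i.ofReal (𝕜 := ℂ)
    simpa using this.div_const 2
  have ht : ∫ y, (1 + X y * Complex.I - (X y : ℂ) ^ 2 / 2) ∂m = 1 - (v : ℂ) / 2 := by
    have hA : Integrable (fun y => (X y : ℂ) * Complex.I) m := hXi.ofReal.mul_const _
    have hB : Integrable (fun y => (X y : ℂ) ^ 2 / 2) m := by
      have := hX2i.ofReal (𝕜 := ℂ)
      simpa using this.div_const 2
    have hC : Integrable (fun y => 1 + (X y : ℂ) * Complex.I) m := (integrable_const _).add hA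
    rw [integral_sub hC hB, integral_add (integrable_const _) hA,
      integral_mul_const, integral_div]
    have h2 : ∫ y, (X y : ℂ) ^ 2 ∂m = (v : ℂ) := by
      rw [hv, ← integral_complex_ofReal]
      simp
    rw [h2, integral_complex_ofReal, h0]
    simp
  have h1 : ‖∫ y, Complex.exp (X y * Complex.I) ∂m - (1 - (v : ℂ) / 2)‖ ≤ 4 * M * v := by
    rw [← ht, ← integral_sub hei hti]
    refine (norm_integral_le_of_norm_le (hX2i.const_mul (4 * M)) ?_).trans
      (integral_const_mul _ _).le
    filter_upwards [hM] with y hy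
    refine (norm_cexp_sub_taylor_le (X y)).trans ?_
    have : |X y| ^ 3 = |X y| * X y ^ 2 := by rw [← sq_abs (X y)]; ring
    rw [this]
    nlinarith [sq_nonneg (X y)]
  have h2 : ‖(1 - (v : ℂ) / 2) - Complex.exp (-(v : ℂ) / 2)‖ ≤ M * v := by
    have hcast : (1 - (v : ℂ) / 2) - Complex.exp (-(v : ℂ) / 2) =
        (((1 - v / 2) - Real.exp (-v / 2) : ℝ) : ℂ) := by push_cast; ring_nf
    rw [hcast, Complex.norm_real, Real.norm_eq_abs]
    have hlow : 1 - v / 2 ≤ Real.exp (-v / 2) := by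
      have := Real.add_one_le_exp (-v / 2); linarith
    rw [abs_of_nonpos (by linarith)]
    rcases le_or_gt M 1 with hM1 | hM1
    · have hvM1 : v ≤ M := by nlinarith
      have h := Real.norm_exp_sub_one_sub_id_le (x := -v / 2)
        (by rw [Real.norm_eq_abs, abs_le]; constructor <;> linarith)
      rw [Real.norm_eq_abs, Real.norm_eq_abs, sq_abs] at h
      have h' := le_abs_self (Real.exp (-v / 2) - 1 - -v / 2)
      nlinarith
    · have : Real.exp (-v / 2) ≤ 1 := Real.exp_le_one_iff.2 (by linarith)
      nlinarith
  calc _ ≤ _ := norm_sub_le_norm_sub_add_norm_sub _ (1 - (v : ℂ) / 2) _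
    _ ≤ 4 * M * v + M * v := add_le_add h1 h2
    _ = _ := by ring

theorem norm_prod_sub_prod_le_sum {ι : Type*} (s : Finset ι) (a b : ι → ℂ)
    (ha : ∀ i ∈ s, ‖a i‖ ≤ 1) (hb : ∀ i ∈ s, ‖b i‖ ≤ 1) :
    ‖∏ i ∈ s, a i - ∏ i ∈ s, b i‖ ≤ ∑ i ∈ s, ‖a i - b i‖ := by
  classical
  induction s using Finset.induction_on with
  | empty => simp
  | insert i s hi ih =>
    rw [Finset.prod_insert hi, Finset.prod_insert hi, Finset.sum_insert hi]
    have hs := ih (fun j hj => ha j (Finset.mem_insert_of_mem hj))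
      (fun j hj => hb j (Finset.mem_insert_of_mem hj))
    have hp : ‖∏ j ∈ s, a j‖ ≤ 1 := by
      rw [norm_prod]
      exact Finset.prod_le_one (fun _ _ => norm_nonneg _)
        fun j hj => ha j (Finset.mem_insert_of_mem hj)
    have heq : a i * ∏ j ∈ s, a j - b i * ∏ j ∈ s, b j =
        (a i - b i) * ∏ j ∈ s, a j + b i * (∏ j ∈ s, a j - ∏ j ∈ s, b j) := by ring
    rw [heq]
    refine (norm_add_le _ _).trans (add_le_add ?_ ?_)
    · rw [norm_mul]
      exact mul_le_of_le_one_right (norm_nonneg _) hp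
    · rw [norm_mul]
      exact (mul_le_of_le_one_left (norm_nonneg _) (hb i (Finset.mem_insert_self _ _))).trans hs

/-- Lindeberg's estimate for a product of characteristic functions of bounded centred variables. -/
theorem norm_prod_integral_cexp_sub_exp_le {ι α : Type*} [Fintype ι] [MeasurableSpace α]
    (m : ι → Measure α) [∀ i, IsProbabilityMeasure (m i)] {X : ι → α → ℝ}
    (hX : ∀ i, Measurable (X i)) {M : ℝ} (hM : ∀ i, ∀ᵐ y ∂m i, |X i y| ≤ M)
    (h0 : ∀ i, ∫ y, X i y ∂m i = 0) :
    ‖∏ i, ∫ y, Complex.exp (X i y * Complex.I) ∂m i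
        - Complex.exp (-((∑ i, ∫ y, X i y ^ 2 ∂m i : ℝ) : ℂ) / 2)‖
      ≤ 5 * M * ∑ i, ∫ y, X i y ^ 2 ∂m i := by
  have he : Complex.exp (-((∑ i, ∫ y, X i y ^ 2 ∂m i : ℝ) : ℂ) / 2) =
      ∏ i, Complex.exp (-((∫ y, X i y ^ 2 ∂m i : ℝ) : ℂ) / 2) := by
    rw [← Complex.exp_sum]
    push_cast
    rw [← Finset.sum_div, Finset.sum_neg_distrib]
  rw [he, Finset.mul_sum]
  refine (norm_prod_sub_prod_le_sum _ _ _ (fun i _ => ?_) (fun i _ => ?_)).trans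
    (Finset.sum_le_sum fun i _ => norm_integral_cexp_sub_exp_le (m i) (hX i) (hM i) (h0 i))
  · refine (norm_integral_le_integral_norm _).trans ?_
    simp [Complex.norm_exp_ofReal_mul_I]
  · have hc : -((∫ y, X i y ^ 2 ∂m i : ℝ) : ℂ) / 2 = ((-(∫ y, X i y ^ 2 ∂m i) / 2 : ℝ) : ℂ) := by
      push_cast; ring
    rw [hc, Complex.norm_exp_ofReal, Real.exp_le_one_iff]
    have : 0 ≤ ∫ y, X i y ^ 2 ∂m i := integral_nonneg fun y => sq_nonneg _
    linarith

/-! ### Scores of the units: assignment patterns and contributions to the estimator -/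

/-- `w` assigns groups to the units in `ι` and `s` marks the labeled ones, so that each group `v`
has `h v` units, `l v` of which are labeled. -/
structure IsPattern {ι : Type*} [Fintype ι] (h l : Bool → ℕ) (w s : ι → Bool) : Prop where
  card_group : ∀ v, (Finset.univ.filter fun i => w i = v).card = h v
  card_labeled : ∀ v, (Finset.univ.filter fun i => s i = true ∧ w i = v).card = l v

/-- A product over the units of factors that depend only on the group and on the label is
determined by the group sizes. -/
@[to_additive /-- A sum over the units of terms that depend only on the group and on the label is
determined by the group sizes. -/]
theorem IsPattern.prod_eq {ι M : Type*} [Fintype ι] [CommMonoid M] {h l : Bool → ℕ}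
    {w s : ι → Bool} (hp : IsPattern h l w s) (F : Bool → Bool → M) :
    ∏ i, F (w i) (s i) = ∏ v, F v true ^ l v * F v false ^ (h v - l v) := by
  rw [← Finset.prod_fiberwise (s := Finset.univ) (g := w)]
  refine Finset.prod_congr rfl fun v _ => ?_
  have hc1 : (Finset.univ.filter fun i => w i = v ∧ s i = true).card = l v := by
    rw [← hp.card_labeled v]; congr 1; ext i; simp [and_comm]
  have hc2 : (Finset.univ.filter fun i => w i = v ∧ ¬ s i = true).card = h v - l v := by
    have := Finset.card_filter_add_card_filter_not
      (s := Finset.univ.filter fun i => w i = v) (fun i => s i = true)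
    rw [Finset.filter_filter, Finset.filter_filter, hc1, hp.card_group] at this
    omega
  rw [← Finset.prod_filter_mul_prod_filter_not _ (fun i => s i = true), Finset.filter_filter,
    Finset.filter_filter]
  congr 1
  · rw [← hc1]
    refine Finset.prod_eq_pow_card fun i hi => ?_
    have := (Finset.mem_filter.1 hi).2
    rw [this.1, this.2]
  · rw [← hc2]
    refine Finset.prod_eq_pow_card fun i hi => ?_
    have := (Finset.mem_filter.1 hi).2
    rw [this.1, eq_false_of_ne_true this.2]

section Contribution

variable {𝒴 : Type*} {k : ℕ}

/-- What a unit of group `v` with document `y` adds to the estimator, where `a` and `b` are the true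
and the machine scores and `s` tells whether the unit is labeled. -/
noncomputable def contribution (h l : Bool → ℕ) (a b : 𝒴 → Fin k → ℝ) (v s : Bool) (y : 𝒴) :
    Fin k → ℝ :=
  fun j => (if v then 1 else -1) *
    (b y j / (h v : ℝ) - if s then (b y j - a y j) / (l v : ℝ) else 0)

theorem measurable_contribution [MeasurableSpace 𝒴] (h l : Bool → ℕ) {a b : 𝒴 → Fin k → ℝ}
    (ha : Measurable a) (hb : Measurable b) (v s : Bool) :
    Measurable (contribution h l a b v s) := by
  refine measurable_pi_lambda _ fun j => ?_
  have h1 : Measurable fun y => a y j := (measurable_pi_apply j).comp ha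
  have h2 : Measurable fun y => b y j := (measurable_pi_apply j).comp hb
  unfold contribution
  cases s <;> simp only [if_true, Bool.false_eq_true, if_false] <;> fun_prop

theorem abs_contribution_le {h l : Bool → ℕ} {a b : 𝒴 → Fin k → ℝ} {v : Bool} (hl : 0 < l v)
    (hle : l v ≤ h v) (s : Bool) {c : ℝ} {y : 𝒴} {j : Fin k} (ha : |a y j| ≤ c)
    (hb : |b y j| ≤ c) : |contribution h l a b v s y j| ≤ 3 * c / (l v : ℝ) := by
  have hl' : (0 : ℝ) < l v := by exact_mod_cast hl
  have hle' : (l v : ℝ) ≤ h v := by exact_mod_cast hle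
  have hc : 0 ≤ c := (abs_nonneg _).trans ha
  have h1 : |b y j / (h v : ℝ)| ≤ c / l v := by
    rw [abs_div, abs_of_pos (hl'.trans_le hle')]
    exact div_le_div₀ hc hb hl' hle'
  have h2 : |(if s then (b y j - a y j) / (l v : ℝ) else 0)| ≤ 2 * c / l v := by
    cases s
    · simp; positivity
    · simp only [if_true]
      rw [abs_div, abs_of_pos hl']
      refine div_le_div_of_nonneg_right ?_ hl'.le
      exact (abs_sub _ _).trans (by linarith)
  have h3 : |((if v then 1 else -1 : ℝ))| = 1 := by cases v <;> simp
  unfold contribution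
  rw [abs_mul, h3, one_mul]
  refine (abs_sub _ _).trans ((add_le_add h1 h2).trans (le_of_eq ?_))
  ring

/-- The asymptotic variance of the estimator as a function of the group sizes and of the score
functions. -/
noncomputable def asympVar [MeasurableSpace 𝒴] (P : Bool → Measure 𝒴) (h l : Bool → ℕ)
    (a b : 𝒴 → Fin k → ℝ) : Matrix (Fin k) (Fin k) ℝ :=
  ∑ v, (((min (l true) (l false) : ℕ) : ℝ) / (l v : ℝ)) •
    (((l v : ℝ) / (h v : ℝ)) • scoreVar (P v) a
      + (1 - (l v : ℝ) / (h v : ℝ)) • scoreVar (P v) (fun y => b y - a y))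

/-- The law of `r (τ̂ - τ)` when the group and label pattern `(w, s)` and the score functions are
fixed and the documents are independent draws. -/
noncomputable def errorLaw {ι : Type*} [Fintype ι] [MeasurableSpace 𝒴] (P : Bool → Measure 𝒴)
    (h l : Bool → ℕ) (r : ℝ) (a b : 𝒴 → Fin k → ℝ) (w s : ι → Bool) : Measure (Fin k → ℝ) :=
  (Measure.pi fun i => P (w i)).map fun y =>
    r • (∑ i, contribution h l a b (w i) (s i) (y i) - (scoreMean (P true) a - scoreMean (P false) a))

variable [MeasurableSpace 𝒴] {P : Bool → Measure 𝒴} [∀ v, IsProbabilityMeasure (P v)]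
  {h l : Bool → ℕ} {a b : 𝒴 → Fin k → ℝ} {ι : Type*} [Fintype ι] {w s : ι → Bool}

theorem measurable_sum_contribution (ha : Measurable a) (hb : Measurable b) (r : ℝ)
    (τ : Fin k → ℝ) (w s : ι → Bool) :
    Measurable fun y : ι → 𝒴 => r • (∑ i, contribution h l a b (w i) (s i) (y i) - τ) := by
  have : Measurable fun y : ι → 𝒴 => ∑ i, contribution h l a b (w i) (s i) (y i) :=
    Finset.measurable_fun_sum _ fun i _ =>
      (measurable_contribution h l ha hb _ _).comp (measurable_pi_apply i)
  exact (this.sub_const τ).const_smul r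

theorem isProbabilityMeasure_errorLaw (ha : Measurable a) (hb : Measurable b) (r : ℝ) :
    IsProbabilityMeasure (errorLaw P h l r a b w s) :=
  Measure.isProbabilityMeasure_map (measurable_sum_contribution ha hb r _ w s).aemeasurable

theorem charFun_errorLaw (ha : Measurable a) (hb : Measurable b) (r : ℝ)
    (u : EuclideanSpace ℝ (Fin k)) :
    charFun ((errorLaw P h l r a b w s).map (WithLp.toLp 2)) u =
      Complex.exp (((-(r * (u.ofLp ⬝ᵥ (scoreMean (P true) a - scoreMean (P false) a))) : ℝ) : ℂ)
          * Complex.I) *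
        ∏ i, ∫ y, Complex.exp (((r * (u.ofLp ⬝ᵥ contribution h l a b (w i) (s i) y) : ℝ) : ℂ)
          * Complex.I) ∂P (w i) := by
  have hT := measurable_sum_contribution (h := h) (l := l) ha hb r
    (scoreMean (P true) a - scoreMean (P false) a) w s
  have hL : Measurable (WithLp.toLp 2 : (Fin k → ℝ) → EuclideanSpace ℝ (Fin k)) :=
    (PiLp.continuous_toLp 2 _).measurable
  rw [charFun_apply, errorLaw, Measure.map_map hL hT,
    integral_map (hL.comp hT).aemeasurable (by fun_prop), ← integral_fintype_prod_eq_prod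
      (fun i y => Complex.exp (((r * (u.ofLp ⬝ᵥ contribution h l a b (w i) (s i) y) : ℝ) : ℂ)
          * Complex.I)), ← integral_const_mul]
  refine integral_congr_ae (ae_of_all _ fun y => ?_)
  simp only [Function.comp_apply]
  rw [← Complex.exp_sum, ← Complex.exp_add, ← Finset.sum_mul, ← add_mul]
  congr 2
  rw [← Complex.ofReal_sum, ← Complex.ofReal_add]
  congr 1
  rw [← Finset.mul_sum]
  have : inner ℝ (WithLp.toLp 2 (r • (∑ i, contribution h l a b (w i) (s i) (y i)
      - (scoreMean (P true) a - scoreMean (P false) a)))) u =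
      u.ofLp ⬝ᵥ (r • (∑ i, contribution h l a b (w i) (s i) (y i)
      - (scoreMean (P true) a - scoreMean (P false) a))) := by
    simp [PiLp.inner_apply, dotProduct]
  rw [this, dotProduct_smul, dotProduct_sub, dotProduct_sum, smul_eq_mul]
  ring

/-- Only the numbers of units matter for the law of the error, not which units are labeled. -/
theorem errorLaw_eq_of_isPattern (ha : Measurable a) (hb : Measurable b) (r : ℝ) {w' s' : ι → Bool}
    (hp : IsPattern h l w s) (hp' : IsPattern h l w' s') :
    errorLaw P h l r a b w s = errorLaw P h l r a b w' s' := by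
  have h1 := isProbabilityMeasure_errorLaw (P := P) (h := h) (l := l) (w := w) (s := s) ha hb r
  have h2 := isProbabilityMeasure_errorLaw (P := P) (h := h) (l := l) (w := w') (s := s') ha hb r
  have hL : MeasurableEmbedding (WithLp.toLp 2 : (Fin k → ℝ) → EuclideanSpace ℝ (Fin k)) :=
    (MeasurableEquiv.toLp 2 (Fin k → ℝ)).measurableEmbedding
  have h3 := Measure.isProbabilityMeasure_map (μ := errorLaw P h l r a b w s)
    hL.measurable.aemeasurable
  have h4 := Measure.isProbabilityMeasure_map (μ := errorLaw P h l r a b w' s')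
    hL.measurable.aemeasurable
  have key : (errorLaw P h l r a b w s).map (WithLp.toLp 2) =
      (errorLaw P h l r a b w' s').map (WithLp.toLp 2 : _ → EuclideanSpace ℝ (Fin k)) := by
    refine Measure.ext_of_charFun (funext fun u => ?_)
    rw [charFun_errorLaw ha hb, charFun_errorLaw ha hb]
    congr 1
    rw [hp.prod_eq fun v t => ∫ y, Complex.exp (((r * (u.ofLp ⬝ᵥ contribution h l a b v t y) : ℝ) : ℂ)
          * Complex.I) ∂P v,
      hp'.prod_eq fun v t => ∫ y, Complex.exp (((r * (u.ofLp ⬝ᵥ contribution h l a b v t y) : ℝ) : ℂ)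
          * Complex.I) ∂P v]
  ext B hB
  have := congrArg (fun ρ : Measure (EuclideanSpace ℝ (Fin k)) => ρ (WithLp.toLp 2 '' B)) key
  simpa [hL.map_apply, Set.preimage_image_eq _ hL.injective] using this

end Contribution

/-! ### Mean and variance of the estimation error for fixed score functions -/

section ScoreMoments

variable {𝒴 : Type*} [MeasurableSpace 𝒴] {k : ℕ} {Q : Measure 𝒴} [IsProbabilityMeasure Q]
  {s : 𝒴 → Fin k → ℝ} {c : ℝ}

theorem memLp_coord_of_bound (hs : Measurable s) (hb : ∀ᵐ y ∂Q, ∀ j, |s y j| ≤ c) (j : Fin k)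
    (p : ENNReal) : MemLp (fun y => s y j) p Q :=
  MemLp.of_bound ((measurable_pi_apply j).comp hs).aestronglyMeasurable c
    (by filter_upwards [hb] with y hy using hy j)

theorem memLp_dotProduct_of_bound (hs : Measurable s) (hb : ∀ᵐ y ∂Q, ∀ j, |s y j| ≤ c)
    (u : Fin k → ℝ) (p : ENNReal) : MemLp (fun y => u ⬝ᵥ s y) p Q :=
  memLp_finsetSum _ fun j _ => (memLp_coord_of_bound hs hb j p).const_mul (u j)

theorem dotProduct_scoreVar_mulVec (hs : Measurable s) (hb : ∀ᵐ y ∂Q, ∀ j, |s y j| ≤ c)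
    (u : Fin k → ℝ) : u ⬝ᵥ scoreVar Q s *ᵥ u = Var[fun y => u ⬝ᵥ s y; Q] := by
  simp only [dotProduct]
  rw [variance_fun_sum fun j => (memLp_coord_of_bound hs hb j 2).const_mul (u j)]
  refine Finset.sum_congr rfl fun i _ => ?_
  simp only [Matrix.mulVec, dotProduct, Finset.mul_sum]
  refine Finset.sum_congr rfl fun j _ => ?_
  rw [covariance_const_mul_left, covariance_const_mul_right]
  simp only [scoreVar, Matrix.of_apply]
  ring

theorem posSemidef_scoreVar (hs : Measurable s) (hb : ∀ᵐ y ∂Q, ∀ j, |s y j| ≤ c) :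
    (scoreVar Q s).PosSemidef := by
  have hsymm : (scoreVar Q s).IsHermitian := by
    ext i j
    simp [scoreVar, covariance_comm]
  refine Matrix.PosSemidef.of_dotProduct_mulVec_nonneg hsymm fun u => ?_
  rw [star_trivial, dotProduct_scoreVar_mulVec hs hb]
  exact variance_nonneg _ _

theorem abs_scoreVar_le (hc : 0 ≤ c) (hb : ∀ᵐ y ∂Q, ∀ j, |s y j| ≤ c) (i j : Fin k) :
    |scoreVar Q s i j| ≤ 4 * c ^ 2 := by
  have hmean : ∀ i, |∫ y, s y i ∂Q| ≤ c := fun i => by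
    have := norm_integral_le_of_norm_le_const (μ := Q) (f := fun y => s y i) (C := c)
      (by filter_upwards [hb] with y hy using hy i)
    simpa using this
  simp only [scoreVar, Matrix.of_apply, covariance]
  have := norm_integral_le_of_norm_le_const (μ := Q) (C := 4 * c ^ 2)
    (f := fun y => (s y i - ∫ y, s y i ∂Q) * (s y j - ∫ y, s y j ∂Q))
    (by
      filter_upwards [hb] with y hy
      rw [norm_mul]
      have h1 : ‖s y i - ∫ y, s y i ∂Q‖ ≤ 2 * c :=
        (abs_sub (s y i) _).trans (by linarith [hy i, hmean i])
      have h2 : ‖s y j - ∫ y, s y j ∂Q‖ ≤ 2 * c :=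
        (abs_sub (s y j) _).trans (by linarith [hy j, hmean j])
      calc _ ≤ (2 * c) * (2 * c) := mul_le_mul h1 h2 (norm_nonneg _) (by positivity)
        _ = _ := by ring)
  rwa [probReal_univ, mul_one] at this

end ScoreMoments

/-- The variance identity behind the asymptotic variance: each of the `h - l` unlabeled units
contributes `Var(β / h)`, each of the `l` labeled ones `Var(β / h - (β - α) / l)`. -/
theorem labeled_add_unlabeled_variance {𝒴 : Type*} [MeasurableSpace 𝒴] {Q : Measure 𝒴}
    [IsProbabilityMeasure Q] {α β : 𝒴 → ℝ} (hα : MemLp α 2 Q) (hβ : MemLp β 2 Q) {h l : ℝ}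
    (hl : l ≠ 0) (hh : h ≠ 0) :
    l * Var[fun y => β y / h - (β y - α y) / l; Q] + (h - l) * Var[fun y => β y / h; Q] =
      1 / l * (l / h * Var[α; Q] + (1 - l / h) * Var[fun y => β y - α y; Q]) := by
  have hd : MemLp (fun y => β y - α y) 2 Q := hβ.sub hα
  have h1 : Var[α; Q] = Var[β; Q] - 2 * cov[β, fun y => β y - α y; Q]
      + Var[fun y => β y - α y; Q] := by
    rw [← variance_fun_sub hβ hd]
    simp
  have h2 : Var[fun y => β y / h; Q] = h⁻¹ ^ 2 * Var[β; Q] := by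
    rw [← variance_const_mul]
    simp [div_eq_inv_mul]
  have h3 : Var[fun y => β y / h - (β y - α y) / l; Q] = h⁻¹ ^ 2 * Var[β; Q]
      - 2 * (h⁻¹ * (l⁻¹ * cov[β, fun y => β y - α y; Q]))
      + l⁻¹ ^ 2 * Var[fun y => β y - α y; Q] := by
    have e : (fun y => β y / h - (β y - α y) / l) =
        fun y => h⁻¹ * β y - l⁻¹ * (β y - α y) := by
      ext y; ring
    rw [e, variance_fun_sub (hβ.const_mul _) (hd.const_mul _), variance_const_mul,
      variance_const_mul, covariance_const_mul_left, covariance_const_mul_right]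
  rw [h1, h2, h3]
  field_simp
  ring

theorem dotProduct_contribution {𝒴 : Type*} {k : ℕ} {h l : Bool → ℕ} {a b : 𝒴 → Fin k → ℝ}
    (u : Fin k → ℝ) (v t : Bool) (y : 𝒴) :
    u ⬝ᵥ contribution h l a b v t y = (if v then 1 else -1) *
      ((u ⬝ᵥ b y) / (h v : ℝ) - if t then (u ⬝ᵥ b y - u ⬝ᵥ a y) / (l v : ℝ) else 0) := by
  cases t
  · simp only [contribution, dotProduct, Bool.false_eq_true, if_false, sub_zero, Finset.sum_div,
      Finset.mul_sum]
    exact Finset.sum_congr rfl fun j _ => by ring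
  · simp only [contribution, dotProduct, if_true, ← Finset.sum_sub_distrib, Finset.sum_div,
      Finset.mul_sum]
    exact Finset.sum_congr rfl fun j _ => by ring

theorem ae_abs_contribution_le {𝒴 : Type*} [MeasurableSpace 𝒴] {k : ℕ} {P : Bool → Measure 𝒴}
    {h l : Bool → ℕ} {a b : 𝒴 → Fin k → ℝ} {c : ℝ} (hl : ∀ v, 0 < l v) (hle : ∀ v, l v ≤ h v)
    (hbd : ∀ v, ∀ᵐ y ∂P v, ∀ j, |a y j| ≤ c ∧ |b y j| ≤ c) (v t : Bool) :
    ∀ᵐ y ∂P v, ∀ j, |contribution h l a b v t y j| ≤ 3 * c / (l v : ℝ) := by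
  filter_upwards [hbd v] with y hy j
  exact abs_contribution_le (hl v) (hle v) t (hy j).1 (hy j).2

section FixedScores

variable {𝒴 : Type*} [MeasurableSpace 𝒴] {k : ℕ} {P : Bool → Measure 𝒴}
  [∀ v, IsProbabilityMeasure (P v)] {h l : Bool → ℕ} {a b : 𝒴 → Fin k → ℝ} {c : ℝ}

/-- The estimator is unbiased for fixed score functions. -/
theorem sum_integral_contribution (ha : Measurable a) (hb : Measurable b) (hl : ∀ v, 0 < l v)
    (hle : ∀ v, l v ≤ h v) (hbd : ∀ v, ∀ᵐ y ∂P v, ∀ j, |a y j| ≤ c ∧ |b y j| ≤ c)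
    {ι : Type*} [Fintype ι] {w s : ι → Bool} (hp : IsPattern h l w s) (j : Fin k) :
    ∑ i, ∫ y, contribution h l a b (w i) (s i) y j ∂P (w i) =
      (scoreMean (P true) a - scoreMean (P false) a) j := by
  have hai : ∀ v, Integrable (fun y => a y j) (P v) := fun v => memLp_one_iff_integrable.1
    (memLp_coord_of_bound ha (by filter_upwards [hbd v] with y hy j using (hy j).1) j 1)
  have hbi : ∀ v, Integrable (fun y => b y j) (P v) := fun v => memLp_one_iff_integrable.1
    (memLp_coord_of_bound hb (by filter_upwards [hbd v] with y hy j using (hy j).2) j 1)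
  have hT : ∀ v, ∫ y, contribution h l a b v true y j ∂P v = (if v then 1 else -1) *
      ((∫ y, b y j ∂P v) / (h v : ℝ) - (∫ y, b y j ∂P v - ∫ y, a y j ∂P v) / (l v : ℝ)) := by
    intro v
    simp only [contribution, if_true]
    have hd : Integrable (fun y => (b y j - a y j) / (l v : ℝ)) (P v) :=
      ((hbi v).sub (hai v)).div_const _
    rw [integral_const_mul, integral_sub ((hbi v).div_const _) hd, integral_div, integral_div,
      integral_sub (hbi v) (hai v)]
  have hF : ∀ v, ∫ y, contribution h l a b v false y j ∂P v = (if v then 1 else -1) *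
      ((∫ y, b y j ∂P v) / (h v : ℝ)) := by
    intro v
    simp only [contribution, Bool.false_eq_true, if_false, sub_zero]
    rw [integral_const_mul, integral_div]
  rw [hp.sum_eq fun v t => ∫ y, contribution h l a b v t y j ∂P v]
  have hv : ∀ v, l v • (∫ y, contribution h l a b v true y j ∂P v)
      + (h v - l v) • (∫ y, contribution h l a b v false y j ∂P v) =
      (if v then 1 else -1) * ∫ y, a y j ∂P v := by
    intro v
    have hl' : (l v : ℝ) ≠ 0 := by exact_mod_cast (hl v).ne'
    have hh' : (h v : ℝ) ≠ 0 := by exact_mod_cast ((hl v).trans_le (hle v)).ne'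
    rw [hT, hF, nsmul_eq_mul, nsmul_eq_mul, Nat.cast_sub (hle v)]
    field_simp
    ring
  rw [Finset.sum_congr rfl fun v _ => hv v]
  simp [scoreMean, sub_eq_add_neg]

theorem dotProduct_asympVar_mulVec (ha : Measurable a) (hb : Measurable b)
    (hbd : ∀ v, ∀ᵐ y ∂P v, ∀ j, |a y j| ≤ c ∧ |b y j| ≤ c) (u : Fin k → ℝ) :
    u ⬝ᵥ asympVar P h l a b *ᵥ u = ∑ v, ((min (l true) (l false) : ℕ) : ℝ) * (1 / (l v : ℝ) *
      ((l v : ℝ) / (h v : ℝ) * Var[fun y => u ⬝ᵥ a y; P v]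
        + (1 - (l v : ℝ) / (h v : ℝ)) * Var[fun y => u ⬝ᵥ b y - u ⬝ᵥ a y; P v])) := by
  have hA : ∀ v, ∀ᵐ y ∂P v, ∀ j, |a y j| ≤ c := fun v => by
    filter_upwards [hbd v] with y hy j using (hy j).1
  have hD : ∀ v, ∀ᵐ y ∂P v, ∀ j, |(b y - a y) j| ≤ 2 * c := fun v => by
    filter_upwards [hbd v] with y hy j
    exact (abs_sub _ _).trans (by linarith [(hy j).1, (hy j).2])
  simp only [asympVar, Matrix.sum_mulVec, dotProduct_sum, Matrix.smul_mulVec, Matrix.add_mulVec,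
    dotProduct_smul, dotProduct_add, smul_eq_mul]
  refine Finset.sum_congr rfl fun v _ => ?_
  rw [dotProduct_scoreVar_mulVec ha (hA v),
    dotProduct_scoreVar_mulVec (s := fun y => b y - a y) (hb.sub ha) (hD v)]
  simp only [dotProduct_sub]
  ring

theorem posSemidef_asympVar (ha : Measurable a) (hb : Measurable b) (hle : ∀ v, l v ≤ h v)
    (hbd : ∀ v, ∀ᵐ y ∂P v, ∀ j, |a y j| ≤ c ∧ |b y j| ≤ c) :
    (asympVar P h l a b).PosSemidef := by
  refine Matrix.posSemidef_sum _ fun v _ => Matrix.PosSemidef.smul (Matrix.PosSemidef.add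
    (Matrix.PosSemidef.smul (posSemidef_scoreVar (c := c) ha ?_) (by positivity))
    (Matrix.PosSemidef.smul (posSemidef_scoreVar (c := 2 * c) (hb.sub ha) ?_) ?_)) (by positivity)
  · filter_upwards [hbd v] with y hy j using (hy j).1
  · filter_upwards [hbd v] with y hy j
    exact (abs_sub _ _).trans (by linarith [(hy j).1, (hy j).2])
  · have : (l v : ℝ) / h v ≤ 1 :=
      div_le_one_of_le₀ (by exact_mod_cast hle v) (by positivity)
    linarith

theorem abs_asympVar_le (hc : 0 ≤ c) (hle : ∀ v, l v ≤ h v)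
    (hbd : ∀ v, ∀ᵐ y ∂P v, ∀ j, |a y j| ≤ c ∧ |b y j| ≤ c) (i j : Fin k) :
    |asympVar P h l a b i j| ≤ 32 * c ^ 2 := by
  have hv : ∀ v, |((((min (l true) (l false) : ℕ) : ℝ) / (l v : ℝ)) •
    (((l v : ℝ) / (h v : ℝ)) • scoreVar (P v) a
      + (1 - (l v : ℝ) / (h v : ℝ)) • scoreVar (P v) (fun y => b y - a y))) i j| ≤ 16 * c ^ 2 := by
    intro v
    have h1 := abs_scoreVar_le (s := a) hc
      (by filter_upwards [hbd v] with y hy j using (hy j).1) i j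
    have h2 := abs_scoreVar_le (Q := P v) (s := fun y => b y - a y) (c := 2 * c) (by positivity)
      (by filter_upwards [hbd v] with y hy j
          exact (abs_sub _ _).trans (by linarith [(hy j).1, (hy j).2])) i j
    have hp0 : 0 ≤ (l v : ℝ) / h v := by positivity
    have hp1 : (l v : ℝ) / h v ≤ 1 :=
      div_le_one_of_le₀ (by exact_mod_cast hle v) (by positivity)
    have hq0 : 0 ≤ ((min (l true) (l false) : ℕ) : ℝ) / (l v : ℝ) := by positivity
    have hq1 : ((min (l true) (l false) : ℕ) : ℝ) / (l v : ℝ) ≤ 1 :=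
      div_le_one_of_le₀ (by cases v <;> simp) (by positivity)
    simp only [Matrix.smul_apply, Matrix.add_apply, smul_eq_mul]
    rw [abs_mul, abs_of_nonneg hq0]
    refine (mul_le_of_le_one_left (abs_nonneg _) hq1).trans ((abs_add_le _ _).trans ?_)
    rw [abs_mul, abs_mul, abs_of_nonneg hp0, abs_of_nonneg (sub_nonneg.2 hp1)]
    nlinarith [sq_nonneg c]
  unfold asympVar
  rw [Fintype.sum_bool, Matrix.add_apply]
  refine (abs_add_le _ _).trans ?_
  linarith [hv true, hv false]

end FixedScores

/-! ### Central limit theorem for fixed score functions -/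

section FixedScoresCLT

variable {𝒴 : Type*} [MeasurableSpace 𝒴] {k : ℕ} {P : Bool → Measure 𝒴}
  [∀ v, IsProbabilityMeasure (P v)] {h l : Bool → ℕ} {a b : 𝒴 → Fin k → ℝ} {c : ℝ}

theorem abs_dotProduct_le {u x : Fin k → ℝ} {B : ℝ} (hx : ∀ j, |x j| ≤ B) :
    |u ⬝ᵥ x| ≤ (∑ j, |u j|) * B := by
  rw [dotProduct, Finset.sum_mul]
  refine (Finset.abs_sum_le_sum_abs _ _).trans (Finset.sum_le_sum fun j _ => ?_)
  rw [abs_mul]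
  exact mul_le_mul_of_nonneg_left (hx j) (abs_nonneg _)

theorem abs_dotProduct_mulVec_le {u : Fin k → ℝ} {A : Matrix (Fin k) (Fin k) ℝ} {B : ℝ}
    (hA : ∀ i j, |A i j| ≤ B) : |u ⬝ᵥ A *ᵥ u| ≤ B * (∑ j, |u j|) ^ 2 := by
  have : |u ⬝ᵥ A *ᵥ u| ≤ (∑ j, |u j|) * ((∑ j, |u j|) * B) := abs_dotProduct_le fun i => by
    rw [Matrix.mulVec, dotProduct_comm]
    exact abs_dotProduct_le (hA i)
  linarith

/-- The scaled variances of the contributions add up to the asymptotic variance. -/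
theorem sum_variance_contribution (ha : Measurable a) (hb : Measurable b) (hl : ∀ v, 0 < l v)
    (hle : ∀ v, l v ≤ h v) (hbd : ∀ v, ∀ᵐ y ∂P v, ∀ j, |a y j| ≤ c ∧ |b y j| ≤ c)
    {ι : Type*} [Fintype ι] {w s : ι → Bool} (hp : IsPattern h l w s) (u : Fin k → ℝ) :
    ((min (l true) (l false) : ℕ) : ℝ) *
        ∑ i, Var[fun y => u ⬝ᵥ contribution h l a b (w i) (s i) y; P (w i)] =
      u ⬝ᵥ asympVar P h l a b *ᵥ u := by
  rw [dotProduct_asympVar_mulVec ha hb hbd,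
    hp.sum_eq fun v t => Var[fun y => u ⬝ᵥ contribution h l a b v t y; P v], Finset.mul_sum]
  refine Finset.sum_congr rfl fun v _ => ?_
  congr 1
  have hα : MemLp (fun y => u ⬝ᵥ a y) 2 (P v) := memLp_dotProduct_of_bound ha
    (by filter_upwards [hbd v] with y hy j using (hy j).1) u 2
  have hβ : MemLp (fun y => u ⬝ᵥ b y) 2 (P v) := memLp_dotProduct_of_bound hb
    (by filter_upwards [hbd v] with y hy j using (hy j).2) u 2
  have hl' : (l v : ℝ) ≠ 0 := by exact_mod_cast (hl v).ne'
  have hh' : (h v : ℝ) ≠ 0 := by exact_mod_cast ((hl v).trans_le (hle v)).ne'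
  rw [← labeled_add_unlabeled_variance hα hβ hl' hh', nsmul_eq_mul, nsmul_eq_mul,
    Nat.cast_sub (hle v)]
  have hs : ((if v then 1 else -1 : ℝ)) ^ 2 = 1 := by cases v <;> simp
  simp only [dotProduct_contribution, variance_const_mul, hs, one_mul, if_true,
    Bool.false_eq_true, if_false, sub_zero]

/-- The characteristic function of the scaled error is close to that of the Gaussian law with the
asymptotic variance, with an error that depends only on the bound on the scores and on the
smaller number of labeled units. -/
theorem norm_charFun_errorLaw_sub_le (hc : 0 ≤ c) (ha : Measurable a) (hb : Measurable b)
    (hl : ∀ v, 0 < l v) (hle : ∀ v, l v ≤ h v)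
    (hbd : ∀ v, ∀ᵐ y ∂P v, ∀ j, |a y j| ≤ c ∧ |b y j| ≤ c)
    {ι : Type*} [Fintype ι] {w s : ι → Bool} (hp : IsPattern h l w s)
    (u : EuclideanSpace ℝ (Fin k)) :
    ‖charFun ((errorLaw P h l (Real.sqrt ((min (l true) (l false) : ℕ) : ℝ)) a b w s).map
          (WithLp.toLp 2)) u
        - Complex.exp (-((u.ofLp ⬝ᵥ asympVar P h l a b *ᵥ u.ofLp : ℝ) : ℂ) / 2)‖ ≤
      5 * (6 * c * ∑ j, |u j|) * (32 * c ^ 2 * (∑ j, |u j|) ^ 2) *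
        (1 / Real.sqrt ((min (l true) (l false) : ℕ) : ℝ)) := by
  have hmpos : 0 < min (l true) (l false) := lt_min (hl true) (hl false)
  have hmle : ∀ v, min (l true) (l false) ≤ l v := by intro v; cases v <;> simp
  set N : ℝ := ((min (l true) (l false) : ℕ) : ℝ) with hN
  have hNpos : 0 < N := Nat.cast_pos.2 hmpos
  set r : ℝ := Real.sqrt N with hr
  have hrpos : 0 < r := Real.sqrt_pos.2 hNpos
  have hrr : r * r = N := Real.mul_self_sqrt hNpos.le
  set D : ℝ := ∑ j, |u j| with hD
  have hD0 : 0 ≤ D := Finset.sum_nonneg fun j _ => abs_nonneg _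
  let m : Bool → Bool → ℝ := fun v t => ∫ y, u.ofLp ⬝ᵥ contribution h l a b v t y ∂P v
  let X : Bool → Bool → 𝒴 → ℝ := fun v t y =>
    r * (u.ofLp ⬝ᵥ contribution h l a b v t y - m v t)
  have hcm : ∀ v t, Measurable (contribution h l a b v t) := measurable_contribution h l ha hb
  have hUm : ∀ v t, Measurable fun y => u.ofLp ⬝ᵥ contribution h l a b v t y := fun v t =>
    Finset.measurable_fun_sum _ fun j _ => ((measurable_pi_apply j).comp (hcm v t)).const_mul _
  have hXm : ∀ v t, Measurable (X v t) := fun v t => ((hUm v t).sub_const _).const_mul _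
  have hcb : ∀ v t, ∀ᵐ y ∂P v, ∀ j, |contribution h l a b v t y j| ≤ 3 * c / (l v : ℝ) :=
    ae_abs_contribution_le hl hle hbd
  have hUi : ∀ v t, Integrable (fun y => u.ofLp ⬝ᵥ contribution h l a b v t y) (P v) :=
    fun v t => memLp_one_iff_integrable.1 (memLp_dotProduct_of_bound (hcm v t) (hcb v t) _ 1)
  have hci : ∀ v t j, Integrable (fun y => contribution h l a b v t y j) (P v) :=
    fun v t j => memLp_one_iff_integrable.1 (memLp_coord_of_bound (hcm v t) (hcb v t) j 1)
  have hX0 : ∀ v t, ∫ y, X v t y ∂P v = 0 := by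
    intro v t
    simp only [X]
    rw [integral_const_mul, integral_sub (hUi v t) (integrable_const _)]
    simp [m]
  have hXb : ∀ v t, ∀ᵐ y ∂P v, |X v t y| ≤ 6 * c * D * (1 / r) := by
    intro v t
    have hlv : 0 < (l v : ℝ) := by exact_mod_cast hl v
    have hmb : |m v t| ≤ D * (3 * c / l v) := by
      have := norm_integral_le_of_norm_le_const (μ := P v) (C := D * (3 * c / l v))
        (f := fun y => u.ofLp ⬝ᵥ contribution h l a b v t y)
        (by filter_upwards [hcb v t] with y hy using abs_dotProduct_le hy)
      rwa [probReal_univ, mul_one] at this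
    filter_upwards [hcb v t] with y hy
    have h1 : |u.ofLp ⬝ᵥ contribution h l a b v t y| ≤ D * (3 * c / l v) := abs_dotProduct_le hy
    have h2 : |u.ofLp ⬝ᵥ contribution h l a b v t y - m v t| ≤ 6 * c * D * (1 / l v) :=
      (abs_sub _ _).trans ((add_le_add h1 hmb).trans (le_of_eq (by ring)))
    have hNl : N ≤ l v := by rw [hN]; exact_mod_cast hmle v
    have h3 : r * (1 / l v) ≤ 1 / r := by
      rw [mul_one_div, div_le_div_iff₀ hlv hrpos, hrr, one_mul]
      exact hNl
    simp only [X]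
    rw [abs_mul, abs_of_pos hrpos]
    calc r * |u.ofLp ⬝ᵥ contribution h l a b v t y - m v t|
        ≤ r * (6 * c * D * (1 / l v)) := mul_le_mul_of_nonneg_left h2 hrpos.le
      _ = 6 * c * D * (r * (1 / l v)) := by ring
      _ ≤ _ := mul_le_mul_of_nonneg_left h3 (by positivity)
  have hXv : ∀ v t, ∫ y, X v t y ^ 2 ∂P v =
      N * Var[fun y => u.ofLp ⬝ᵥ contribution h l a b v t y; P v] := by
    intro v t
    rw [variance_eq_integral (hUm v t).aemeasurable, ← integral_const_mul]
    refine integral_congr_ae (ae_of_all _ fun y => ?_)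
    simp only [X, m]
    rw [mul_pow, sq r, hrr]
  have hsum : ∑ i, ∫ y, X (w i) (s i) y ^ 2 ∂P (w i) =
      u.ofLp ⬝ᵥ asympVar P h l a b *ᵥ u.ofLp := by
    rw [← sum_variance_contribution ha hb hl hle hbd hp, Finset.mul_sum]
    exact Finset.sum_congr rfl fun i _ => hXv _ _
  have hmean : u.ofLp ⬝ᵥ (scoreMean (P true) a - scoreMean (P false) a) =
      ∑ i, m (w i) (s i) := by
    have : ∀ i, m (w i) (s i) =
        ∑ j, u j * ∫ y, contribution h l a b (w i) (s i) y j ∂P (w i) := by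
      intro i
      simp only [m, dotProduct]
      rw [integral_finsetSum _ fun j _ => (hci _ _ j).const_mul _]
      exact Finset.sum_congr rfl fun j _ => integral_const_mul _ _
    rw [Finset.sum_congr rfl fun i _ => this i, Finset.sum_comm, dotProduct]
    refine Finset.sum_congr rfl fun j _ => ?_
    rw [← sum_integral_contribution ha hb hl hle hbd hp j, Finset.mul_sum]
  have hchar : charFun ((errorLaw P h l r a b w s).map (WithLp.toLp 2)) u =
      ∏ i, ∫ y, Complex.exp (X (w i) (s i) y * Complex.I) ∂P (w i) := by
    rw [charFun_errorLaw ha hb, hmean, Finset.mul_sum, ← Finset.sum_neg_distrib,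
      Complex.ofReal_sum, Finset.sum_mul, Complex.exp_sum, ← Finset.prod_mul_distrib]
    refine Finset.prod_congr rfl fun i _ => ?_
    rw [← integral_const_mul]
    refine integral_congr_ae (ae_of_all _ fun y => ?_)
    simp only [X]
    rw [← Complex.exp_add]
    congr 1
    push_cast
    ring
  have main := norm_prod_integral_cexp_sub_exp_le (fun i => P (w i))
    (X := fun i => X (w i) (s i)) (fun i => hXm _ _) (fun i => hXb _ _) (fun i => hX0 _ _)
  rw [← hchar, hsum] at main
  refine main.trans ?_
  have hquad := (le_abs_self _).trans
    (abs_dotProduct_mulVec_le (u := u.ofLp) (abs_asympVar_le (P := P) (h := h) (l := l) hc hle hbd))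
  calc _ ≤ 5 * (6 * c * D * (1 / r)) * (32 * c ^ 2 * D ^ 2) :=
        mul_le_mul_of_nonneg_left hquad (by positivity)
    _ = _ := by ring

/-- For fixed score functions the distribution function of the scaled error is close to the
Gaussian one as soon as enough units of both groups are labeled, uniformly over all score
functions with the given bounds. -/
theorem exists_errorLaw_orthant_close (P : Bool → Measure 𝒴) [∀ v, IsProbabilityMeasure (P v)]
    (k : ℕ) {c e δ : ℝ} (hc : 0 ≤ c) (he : 0 < e) (hδ : 0 < δ) :
    ∃ N : ℕ, ∀ (h l : Bool → ℕ) (a b : 𝒴 → Fin k → ℝ) (ι : Type) [Fintype ι] (w s : ι → Bool),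
      Measurable a → Measurable b → (∀ v, 0 < l v) → (∀ v, l v ≤ h v) →
      (∀ v, ∀ᵐ y ∂P v, ∀ j, |a y j| ≤ c ∧ |b y j| ≤ c) → IsPattern h l w s →
      (∀ i, e ≤ asympVar P h l a b i i) → N ≤ min (l true) (l false) →
      ∀ t : Fin k → ℝ,
        |(errorLaw P h l (Real.sqrt ((min (l true) (l false) : ℕ) : ℝ)) a b w s).real
            {x | ∀ j, x j ≤ t j}
          - (multivariateGaussian 0 (asympVar P h l a b)).real {x | ∀ j, x j ≤ t j}| ≤ δ := by
  obtain ⟨η, hη, H⟩ := exists_charFun_close_imp_orthant_close (ι := Fin k) (32 * c ^ 2) e δ he hδ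
    (fun u => 5 * (6 * c * ∑ j, |u j|) * (32 * c ^ 2 * (∑ j, |u j|) ^ 2))
  obtain ⟨N, hN⟩ := exists_nat_ge ((1 / η) ^ 2)
  refine ⟨N, fun h l a b ι _ w s ha hb hl hle hbd hp hdiag hmin t => ?_⟩
  have hη' : 1 / Real.sqrt ((min (l true) (l false) : ℕ) : ℝ) ≤ η := by
    have h1 : 1 / η ≤ Real.sqrt ((min (l true) (l false) : ℕ) : ℝ) := by
      refine Real.le_sqrt_of_sq_le (hN.trans ?_)
      exact_mod_cast hmin
    exact (one_div_le hη ((by positivity : 0 < 1 / η).trans_le h1)).1 h1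
  have hprob := isProbabilityMeasure_errorLaw (P := P) (h := h) (l := l) (w := w) (s := s) ha hb
    (Real.sqrt ((min (l true) (l false) : ℕ) : ℝ))
  have hL : Measurable (WithLp.toLp 2 : (Fin k → ℝ) → EuclideanSpace ℝ (Fin k)) :=
    (PiLp.continuous_toLp 2 _).measurable
  have hres := H ((errorLaw P h l (Real.sqrt ((min (l true) (l false) : ℕ) : ℝ)) a b w s).map
    (WithLp.toLp 2)) (Measure.isProbabilityMeasure_map hL.aemeasurable) (asympVar P h l a b)
    (posSemidef_asympVar ha hb hle hbd) (abs_asympVar_le hc hle hbd) hdiag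
    (fun u => (norm_charFun_errorLaw_sub_le hc ha hb hl hle hbd hp u).trans
      (mul_le_mul_of_nonneg_left hη' (by positivity))) t
  have hmeas : MeasurableSet {x : EuclideanSpace ℝ (Fin k) | ∀ j, x j ≤ t j} := by
    simp only [Set.ofPred_forall]
    exact MeasurableSet.iInter fun j => measurableSet_le (by fun_prop) measurable_const
  rwa [Measure.real, Measure.map_apply hL hmeas] at hres

end FixedScoresCLT

/-! ### Law of the hold-out documents given the learned objects -/

/-- Under a product measure the coordinates inside and outside of `H` are independent. -/
theorem pi_inter_preimage_restrict {n : ℕ} {𝒴 : Type*} [MeasurableSpace 𝒴] (m : Fin n → Measure 𝒴)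
    [∀ i, IsProbabilityMeasure (m i)] (H : Finset (Fin n)) {B : Set ({i // i ∈ H} → 𝒴)}
    {C : Set ({i // i ∉ H} → 𝒴)} (hB : MeasurableSet B) (hC : MeasurableSet C) :
    Measure.pi m {y | (fun i : {i // i ∈ H} => y i) ∈ B ∧ (fun i : {i // i ∉ H} => y i) ∈ C} =
      Measure.pi (fun i : {i // i ∈ H} => m i) B *
        Measure.pi m {y | (fun i : {i // i ∉ H} => y i) ∈ C} := by
  have hmp := measurePreserving_piEquivPiSubtypeProd m (fun i => i ∈ H)
  have h1 := hmp.measure_preimage (hB.prod hC).nullMeasurableSet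
  have h2 := hmp.measure_preimage (MeasurableSet.univ.prod hC).nullMeasurableSet
  rw [Measure.prod_prod] at h1 h2
  rw [measure_univ, one_mul] at h2
  have e1 : Measure.pi m {y | (fun i : {i // i ∈ H} => y i) ∈ B ∧
      (fun i : {i // i ∉ H} => y i) ∈ C} = Measure.pi (fun i : {i // i ∈ H} => m i) B *
        Measure.pi (fun i : {i // i ∉ H} => m i) C :=
    h1.trans (by congr!)
  have e2 : Measure.pi m {y | (fun i : {i // i ∉ H} => y i) ∈ C} =
      Measure.pi (fun i : {i // i ∉ H} => m i) C := by
    rw [← h2]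
    congr 1
    ext y
    simp [MeasurableEquiv.piEquivPiSubtypeProd, Equiv.piEquivPiSubtypeProd]
  rw [e1, e2]

theorem measure_eq_sum_inter_preimage {α β : Type*} [MeasurableSpace α] [MeasurableSpace β]
    [Fintype β] [MeasurableSingletonClass β] (ν : Measure α) {X : α → β} (hX : Measurable X)
    (D : Set α) : ν D = ∑ x, ν (D ∩ X ⁻¹' {x}) := by
  have h := sum_measure_preimage_singleton (μ := ν.restrict D) (f := X) Finset.univ
    (fun y _ => hX (measurableSet_singleton y))
  simp only [Finset.coe_univ, Set.preimage_univ, Measure.restrict_apply_univ] at h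
  rw [← h]
  refine Finset.sum_congr rfl fun x _ => ?_
  rw [Measure.restrict_apply (hX (measurableSet_singleton x)), Set.inter_comm]

namespace HoldOutStudy

variable {Ω 𝒴 Θ Ψ : Type*} [MeasurableSpace Ω] [MeasurableSpace 𝒴] [MeasurableSpace Θ]
  [MeasurableSpace Ψ] {S : HoldOutStudy Ω 𝒴 Θ Ψ}

/-- The documents of the hold-out units. -/
def holdOutDocs (S : HoldOutStudy Ω 𝒴 Θ Ψ) (ω : Ω) : {i // i ∈ S.holdOut} → 𝒴 :=
  fun i => S.Y ω i

/-- The event that the hold-out units have groups `p.1` and labels `p.2`. -/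
def patternEvent (S : HoldOutStudy Ω 𝒴 Θ Ψ)
    (p : ({i // i ∈ S.holdOut} → Bool) × ({i // i ∈ S.holdOut} → Bool)) : Set Ω :=
  {ω | (fun i : {i // i ∈ S.holdOut} => S.W ω i) = p.1 ∧
    (fun i : {i // i ∈ S.holdOut} => S.L ω i) = p.2}

variable {μ : Measure Ω} {P : Bool → Measure 𝒴}

theorem IsSampled.measurable_holdOutDocs (hS : S.IsSampled μ P) : Measurable S.holdOutDocs :=
  measurable_pi_lambda _ fun _ => (measurable_pi_apply _).comp hS.measurable_Y

theorem IsSampled.measurable_trainingData (hS : S.IsSampled μ P) : Measurable S.trainingData :=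
  measurable_pi_lambda _ fun _ => ((measurable_pi_apply _).comp hS.measurable_Y).prodMk
    ((measurable_pi_apply _).comp hS.measurable_W)

theorem IsSampled.measurable_learned (hS : S.IsSampled μ P) : Measurable S.learned :=
  hS.measurable_themes.prodMk hS.measurable_scorer

theorem IsSampled.measurableSet_patternEvent (hS : S.IsSampled μ P)
    (p : ({i // i ∈ S.holdOut} → Bool) × ({i // i ∈ S.holdOut} → Bool)) :
    MeasurableSet (S.patternEvent p) := by
  have h1 : Measurable fun ω => (fun i : {i // i ∈ S.holdOut} => S.W ω i) :=
    measurable_pi_lambda _ fun _ => (measurable_pi_apply _).comp hS.measurable_W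
  have h2 : Measurable fun ω => (fun i : {i // i ∈ S.holdOut} => S.L ω i) :=
    measurable_pi_lambda _ fun _ => (measurable_pi_apply _).comp hS.measurable_L
  exact (h1 (measurableSet_singleton p.1)).inter (h2 (measurableSet_singleton p.2))

variable [IsProbabilityMeasure μ] [∀ v, IsProbabilityMeasure (P v)]

/-- Given the groups and the labels of the hold-out units, their documents are independent of the
training data, with the product law. -/
theorem IsSampled.measure_training_inter_pattern_inter_docs (hS : S.IsSampled μ P)
    (p : ({i // i ∈ S.holdOut} → Bool) × ({i // i ∈ S.holdOut} → Bool))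
    {B : Set ({i // i ∈ S.holdOut} → 𝒴)} (hB : MeasurableSet B)
    {C : Set ({i // i ∉ S.holdOut} → 𝒴 × Bool)} (hC : MeasurableSet C) :
    μ (S.trainingData ⁻¹' C ∩ (S.holdOutDocs ⁻¹' B ∩ S.patternEvent p)) =
      Measure.pi (fun i => P (p.1 i)) B * μ (S.trainingData ⁻¹' C ∩ S.patternEvent p) := by
  rw [measure_eq_sum_inter_preimage μ hS.measurable_W (S.trainingData ⁻¹' C ∩ S.patternEvent p),
    measure_eq_sum_inter_preimage μ hS.measurable_W, Finset.mul_sum]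
  refine Finset.sum_congr rfl fun w _ => ?_
  by_cases hw : (fun i : {i // i ∈ S.holdOut} => w i) = p.1
  swap
  · have he : S.patternEvent p ∩ S.W ⁻¹' {w} = ∅ := by
      ext ω
      simp only [Set.mem_inter_iff, Set.mem_preimage, Set.mem_singleton_iff,
        Set.mem_empty_iff_false, iff_false, not_and]
      rintro h1 rfl
      exact hw h1.1
    rw [Set.inter_assoc, Set.inter_assoc, Set.inter_assoc, he]
    simp
  by_cases h0 : μ (S.W ⁻¹' {w}) = 0
  · rw [measure_mono_null Set.inter_subset_right h0, measure_mono_null Set.inter_subset_right h0,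
      mul_zero]
  have hWm : MeasurableSet (S.W ⁻¹' {w}) := hS.measurable_W (measurableSet_singleton w)
  -- On the event `W = w` everything is a product event for documents and labels.
  have key : ∀ B' : Set ({i // i ∈ S.holdOut} → 𝒴), MeasurableSet B' →
      μ (S.trainingData ⁻¹' C ∩ (S.holdOutDocs ⁻¹' B' ∩ S.patternEvent p) ∩ S.W ⁻¹' {w}) =
        Measure.pi (fun i => P (p.1 i)) B' *
          (Measure.pi (fun i => P (w i)) {y | (fun i : {i // i ∉ S.holdOut} => y i) ∈
              (fun z : {i // i ∉ S.holdOut} → 𝒴 => fun i => (z i, w i)) ⁻¹' C} *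
            uniformOn (S.labelSets w)
              {s | (fun i : {i // i ∈ S.holdOut} => s i) = p.2}) * μ (S.W ⁻¹' {w}) := by
    intro B' hB'
    have hC' : MeasurableSet
        ((fun z : {i // i ∉ S.holdOut} → 𝒴 => fun i => (z i, w i)) ⁻¹' C) :=
      (measurable_pi_lambda _ fun i => (measurable_pi_apply i).prodMk measurable_const) hC
    have hrestr : Measurable fun (y : Fin S.n → 𝒴) (i : {i // i ∉ S.holdOut}) => y i :=
      measurable_pi_lambda _ fun i => measurable_pi_apply _
    have hD1 : MeasurableSet {y : Fin S.n → 𝒴 | (fun i : {i // i ∈ S.holdOut} => y i) ∈ B' ∧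
        (fun i : {i // i ∉ S.holdOut} => y i) ∈
          (fun z : {i // i ∉ S.holdOut} → 𝒴 => fun i => (z i, w i)) ⁻¹' C} :=
      ((measurable_pi_lambda _ fun i => measurable_pi_apply _) hB').inter
        (hrestr hC')
    have hD2 : MeasurableSet {s : Fin S.n → Bool |
        (fun i : {i // i ∈ S.holdOut} => s i) = p.2} := MeasurableSet.of_discrete
    have hev : S.trainingData ⁻¹' C ∩ (S.holdOutDocs ⁻¹' B' ∩ S.patternEvent p) ∩ S.W ⁻¹' {w} =
        S.W ⁻¹' {w} ∩ (fun ω => (S.Y ω, S.L ω)) ⁻¹'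
          ({y : Fin S.n → 𝒴 | (fun i : {i // i ∈ S.holdOut} => y i) ∈ B' ∧
            (fun i : {i // i ∉ S.holdOut} => y i) ∈
              (fun z : {i // i ∉ S.holdOut} → 𝒴 => fun i => (z i, w i)) ⁻¹' C} ×ˢ
            {s : Fin S.n → Bool | (fun i : {i // i ∈ S.holdOut} => s i) = p.2}) := by
      ext ω
      simp only [Set.mem_inter_iff, Set.mem_preimage, Set.mem_singleton_iff, Set.mem_prod,
        patternEvent, Set.mem_ofPred_eq]
      constructor
      · rintro ⟨⟨h1, h2, h3, h4⟩, rfl⟩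
        exact ⟨rfl, ⟨h2, h1⟩, h4⟩
      · rintro ⟨rfl, ⟨h2, h1⟩, h4⟩
        exact ⟨⟨h1, h2, hw, h4⟩, rfl⟩
    have hYL : Measurable fun ω => (S.Y ω, S.L ω) := hS.measurable_Y.prodMk hS.measurable_L
    rw [hev, ← cond_mul_eq_inter hWm, ← Measure.map_apply hYL (hD1.prod hD2), hS.law w h0,
      Measure.prod_prod, pi_inter_preimage_restrict _ _ hB' hC', mul_assoc _ _ (uniformOn _ _)]
    rw [← hw]
  have h1 := key B hB
  have h2 := key Set.univ MeasurableSet.univ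
  rw [Set.preimage_univ, Set.univ_inter, measure_univ, one_mul] at h2
  rw [h1, h2, mul_assoc]

/-- The conditional form of the previous identity, given the training data. -/
theorem IsSampled.condExp_docs_inter_pattern (hS : S.IsSampled μ P)
    (p : ({i // i ∈ S.holdOut} → Bool) × ({i // i ∈ S.holdOut} → Bool))
    {B : Set ({i // i ∈ S.holdOut} → 𝒴)} (hB : MeasurableSet B) :
    μ⟦S.holdOutDocs ⁻¹' B ∩ S.patternEvent p | MeasurableSpace.comap S.trainingData inferInstance⟧
      =ᵐ[μ] fun ω => (Measure.pi (fun i => P (p.1 i))).real B *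
        (μ⟦S.patternEvent p | MeasurableSpace.comap S.trainingData inferInstance⟧) ω := by
  have hm : MeasurableSpace.comap S.trainingData inferInstance ≤ (inferInstance : MeasurableSpace Ω) :=
    hS.measurable_trainingData.comap_le
  have hE := hS.measurableSet_patternEvent p
  have hF : MeasurableSet (S.holdOutDocs ⁻¹' B ∩ S.patternEvent p) :=
    (hS.measurable_holdOutDocs hB).inter hE
  refine (ae_eq_condExp_of_forall_setIntegral_eq hm ((integrable_const (1 : ℝ)).indicator hF)
    (fun D _ _ => (integrable_condExp.const_mul _).integrableOn) ?_ ?_).symm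
  · rintro D ⟨C, hC, rfl⟩ -
    have hCm := hS.measurable_trainingData hC
    rw [integral_const_mul, setIntegral_condExp hm ((integrable_const (1 : ℝ)).indicator hE)
      ⟨C, hC, rfl⟩, integral_indicator hE, integral_indicator hF, Measure.restrict_restrict hE,
      Measure.restrict_restrict hF]
    simp only [integral_const, smul_eq_mul, mul_one, Measure.real, Measure.restrict_apply_univ]
    rw [Set.inter_comm _ (S.trainingData ⁻¹' C), Set.inter_comm _ (S.trainingData ⁻¹' C),
      hS.measure_training_inter_pattern_inter_docs p hB hC, ENNReal.toReal_mul]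
  · exact (stronglyMeasurable_condExp.const_mul _).aestronglyMeasurable

theorem IsSampled.measure_learned_inter_pattern_inter_docs (hS : S.IsSampled μ P)
    (p : ({i // i ∈ S.holdOut} → Bool) × ({i // i ∈ S.holdOut} → Bool))
    {B : Set ({i // i ∈ S.holdOut} → 𝒴)} (hB : MeasurableSet B) {A : Set (Θ × Ψ)}
    (hA : MeasurableSet A) :
    μ (S.learned ⁻¹' A ∩ (S.holdOutDocs ⁻¹' B ∩ S.patternEvent p)) =
      μ (S.learned ⁻¹' A ∩ S.patternEvent p) * Measure.pi (fun i => P (p.1 i)) B := by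
  have hm : MeasurableSpace.comap S.trainingData inferInstance ≤ (inferInstance : MeasurableSpace Ω) :=
    hS.measurable_trainingData.comap_le
  have hdata : ∀ B' : Set ({i // i ∈ S.holdOut} → 𝒴), MeasurableSet B' →
      μ⟦S.learned ⁻¹' A ∩ (S.holdOutDocs ⁻¹' B' ∩ S.patternEvent p) |
          MeasurableSpace.comap S.trainingData inferInstance⟧
        =ᵐ[μ] fun ω =>
          (μ⟦S.learned ⁻¹' A | MeasurableSpace.comap S.trainingData inferInstance⟧) ω *
          (μ⟦S.holdOutDocs ⁻¹' B' ∩ S.patternEvent p |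
            MeasurableSpace.comap S.trainingData inferInstance⟧) ω := by
    intro B' hB'
    have h1 : MeasurableSet {d : {i // i ∈ S.holdOut} → 𝒴 × Bool × Bool |
        (fun i => (d i).1) ∈ B' ∧ (fun i => (d i).2.1) = p.1 ∧ (fun i => (d i).2.2) = p.2} := by
      have f1 : Measurable fun d : {i // i ∈ S.holdOut} → 𝒴 × Bool × Bool => fun i => (d i).1 := by
        fun_prop
      have f2 : Measurable fun d : {i // i ∈ S.holdOut} → 𝒴 × Bool × Bool => fun i => (d i).2.1 := by
        fun_prop
      have f3 : Measurable fun d : {i // i ∈ S.holdOut} → 𝒴 × Bool × Bool => fun i => (d i).2.2 := by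
        fun_prop
      exact (f1 hB').inter ((f2 (measurableSet_singleton p.1)).inter
        (f3 (measurableSet_singleton p.2)))
    exact hS.condIndep A _ hA h1
  have hE := hS.measurableSet_patternEvent p
  have hAm := hS.measurable_learned hA
  have hreal : ∀ D : Set Ω, MeasurableSet D → μ.real D =
      ∫ ω, (μ⟦D | MeasurableSpace.comap S.trainingData inferInstance⟧) ω ∂μ := by
    intro D hD
    rw [integral_condExp hm, integral_indicator hD]
    simp
  have h1 := hdata B hB
  have h2 := hdata Set.univ MeasurableSet.univ
  have h3 := hS.condExp_docs_inter_pattern p hB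
  simp only [Set.preimage_univ, Set.univ_inter] at h2
  have hr : μ.real (S.learned ⁻¹' A ∩ (S.holdOutDocs ⁻¹' B ∩ S.patternEvent p)) =
      μ.real (S.learned ⁻¹' A ∩ S.patternEvent p) * (Measure.pi (fun i => P (p.1 i))).real B := by
    rw [hreal _ (hAm.inter ((hS.measurable_holdOutDocs hB).inter hE)), hreal _ (hAm.inter hE),
      ← integral_mul_const]
    refine integral_congr_ae ?_
    filter_upwards [h1, h2, h3] with ω e1 e2 e3
    rw [e1, e2, e3]
    ring
  rw [← ENNReal.toReal_eq_toReal_iff' (measure_ne_top _ _)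
    (ENNReal.mul_ne_top (measure_ne_top _ _) (measure_ne_top _ _)), ENNReal.toReal_mul]
  exact hr

/-- On the event that the hold-out units have a given group and label pattern, the learned objects
are independent of the hold-out documents, which follow the product law. -/
theorem IsSampled.map_learned_docs (hS : S.IsSampled μ P)
    (p : ({i // i ∈ S.holdOut} → Bool) × ({i // i ∈ S.holdOut} → Bool)) :
    (μ.restrict (S.patternEvent p)).map (fun ω => (S.learned ω, S.holdOutDocs ω)) =
      ((μ.restrict (S.patternEvent p)).map S.learned).prod
        (Measure.pi fun i => P (p.1 i)) := by
  symm
  refine Measure.prod_eq fun A B hA hB => ?_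
  rw [Measure.map_apply (hS.measurable_learned.prodMk hS.measurable_holdOutDocs) (hA.prod hB),
    Measure.map_apply hS.measurable_learned hA,
    Measure.restrict_apply ((hS.measurable_learned.prodMk hS.measurable_holdOutDocs) (hA.prod hB)),
    Measure.restrict_apply (hS.measurable_learned hA),
    ← hS.measure_learned_inter_pattern_inter_docs p hB hA, ← Set.inter_assoc]
  rfl

end HoldOutStudy

/-! ### The conditional law of the estimation error -/

namespace HoldOutStudy

variable {Ω 𝒴 Θ Ψ : Type*} {k : ℕ}

/-- The estimator is a sum of contributions of the hold-out units. -/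
theorem tauHat_eq_sum_contribution (S : HoldOutStudy Ω 𝒴 Θ Ψ) (f : Θ → 𝒴 → Fin k → ℝ)
    (g : Ψ → 𝒴 → Fin k → ℝ) (ω : Ω) :
    S.tauHat f g ω = ∑ i : {i // i ∈ S.holdOut}, contribution S.h S.l (f (S.themes ω))
      (g (S.scorer ω)) (S.W ω i) (S.L ω i) (S.Y ω i) := by
  rw [Finset.sum_coe_sort S.holdOut fun i => contribution S.h S.l (f (S.themes ω))
      (g (S.scorer ω)) (S.W ω i) (S.L ω i) (S.Y ω i)]
  ext j
  simp only [tauHat, machineMean, errorMean, machineScore, trueScore, Pi.sub_apply, Pi.smul_apply,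
    Finset.sum_apply, smul_eq_mul, Finset.mul_sum, Finset.sum_filter, ← Finset.sum_sub_distrib]
  refine Finset.sum_congr rfl fun i _ => ?_
  simp only [contribution]
  cases S.W ω i <;> cases S.L ω i <;> simp <;> ring

theorem disjoint_patternEvent (S : HoldOutStudy Ω 𝒴 Θ Ψ) :
    Pairwise (Function.onFun Disjoint fun p => S.patternEvent p) := by
  intro p q hpq
  refine Set.disjoint_left.2 fun ω hp hq => hpq ?_
  exact Prod.ext (hp.1.symm.trans hq.1) (hp.2.symm.trans hq.2)

variable [MeasurableSpace 𝒴] {S : HoldOutStudy Ω 𝒴 Θ Ψ} {P : Bool → Measure 𝒴}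
  {f : Θ → 𝒴 → Fin k → ℝ} {g : Ψ → 𝒴 → Fin k → ℝ}

theorem sigma_eq_asympVar (ω : Ω) :
    S.sigma P f g ω = asympVar P S.h S.l (f (S.themes ω)) (g (S.scorer ω)) := by
  rw [asympVar, Fintype.sum_bool]
  rfl

/-- The scaled error as a function of the learned objects and the hold-out documents, for hold-out
units with groups `p.1` and labels `p.2`. -/
noncomputable def patternError (S : HoldOutStudy Ω 𝒴 Θ Ψ) (P : Bool → Measure 𝒴)
    (f : Θ → 𝒴 → Fin k → ℝ) (g : Ψ → 𝒴 → Fin k → ℝ)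
    (p : ({i // i ∈ S.holdOut} → Bool) × ({i // i ∈ S.holdOut} → Bool))
    (z : (Θ × Ψ) × ({i // i ∈ S.holdOut} → 𝒴)) : Fin k → ℝ :=
  Real.sqrt (S.lmin : ℝ) •
    (∑ i, contribution S.h S.l (f z.1.1) (g z.1.2) (p.1 i) (p.2 i) (z.2 i)
      - (scoreMean (P true) (f z.1.1) - scoreMean (P false) (f z.1.1)))

theorem scaledError_eq_patternError
    {p : ({i // i ∈ S.holdOut} → Bool) × ({i // i ∈ S.holdOut} → Bool)} {ω : Ω}
    (hω : ω ∈ S.patternEvent p) :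
    S.scaledError P f g ω = S.patternError P f g p (S.learned ω, S.holdOutDocs ω) := by
  rw [scaledError, tauHat_eq_sum_contribution, patternError, ← hω.1, ← hω.2]
  rfl

variable [MeasurableSpace Θ] [MeasurableSpace Ψ]

theorem measurable_scoreMean {Q : Measure 𝒴} [SFinite Q] (hf : Measurable (Function.uncurry f)) :
    Measurable fun θ => scoreMean Q (f θ) := by
  refine measurable_pi_lambda _ fun j => ?_
  have h1 : StronglyMeasurable (Function.uncurry fun θ y => f θ y j) :=
    ((measurable_pi_apply j).comp hf).stronglyMeasurable
  exact h1.integral_prod_right.measurable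

theorem measurable_patternError [∀ v, IsProbabilityMeasure (P v)]
    (hf : Measurable (Function.uncurry f)) (hg : Measurable (Function.uncurry g))
    (p : ({i // i ∈ S.holdOut} → Bool) × ({i // i ∈ S.holdOut} → Bool)) :
    Measurable (S.patternError P f g p) := by
  have hc : ∀ v t, Measurable fun z : (Θ × Ψ) × 𝒴 =>
      contribution S.h S.l (f z.1.1) (g z.1.2) v t z.2 := fun v t =>
    measurable_contribution S.h S.l (a := fun z : (Θ × Ψ) × 𝒴 => f z.1.1 z.2)
      (b := fun z => g z.1.2 z.2)
      (hf.comp ((measurable_fst.comp measurable_fst).prodMk measurable_snd))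
      (hg.comp ((measurable_snd.comp measurable_fst).prodMk measurable_snd)) v t
  have hsum : Measurable fun z : (Θ × Ψ) × ({i // i ∈ S.holdOut} → 𝒴) =>
      ∑ i, contribution S.h S.l (f z.1.1) (g z.1.2) (p.1 i) (p.2 i) (z.2 i) :=
    Finset.measurable_fun_sum _ fun i _ => (hc (p.1 i) (p.2 i)).comp
      (measurable_fst.prodMk ((measurable_pi_apply i).comp measurable_snd))
  have hm : ∀ v, Measurable fun z : (Θ × Ψ) × ({i // i ∈ S.holdOut} → 𝒴) =>
      scoreMean (P v) (f z.1.1) := fun v =>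
    (measurable_scoreMean hf).comp (measurable_fst.comp measurable_fst)
  exact (hsum.sub ((hm true).sub (hm false))).const_smul (Real.sqrt (S.lmin : ℝ))

/-- The law of the scaled error given the learned objects, as a kernel. -/
noncomputable def errorKernel (S : HoldOutStudy Ω 𝒴 Θ Ψ) (P : Bool → Measure 𝒴)
    (f : Θ → 𝒴 → Fin k → ℝ) (g : Ψ → 𝒴 → Fin k → ℝ)
    (p : ({i // i ∈ S.holdOut} → Bool) × ({i // i ∈ S.holdOut} → Bool)) :
    Kernel (Θ × Ψ) (Fin k → ℝ) :=
  (Kernel.id ×ₖ Kernel.const (Θ × Ψ) (Measure.pi fun i => P (p.1 i))).map (S.patternError P f g p)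

theorem errorKernel_apply [∀ v, IsProbabilityMeasure (P v)] (hf : Measurable (Function.uncurry f))
    (hg : Measurable (Function.uncurry g))
    (p : ({i // i ∈ S.holdOut} → Bool) × ({i // i ∈ S.holdOut} → Bool)) (x : Θ × Ψ) :
    S.errorKernel P f g p x = errorLaw P S.h S.l
      (Real.sqrt ((min (S.l true) (S.l false) : ℕ) : ℝ)) (f x.1) (g x.2) p.1 p.2 := by
  have hm := measurable_patternError (S := S) (P := P) hf hg p
  rw [errorKernel, Kernel.map_apply _ hm, Kernel.prod_apply, Kernel.id_apply, Kernel.const_apply,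
    Measure.dirac_prod, Measure.map_map hm measurable_prodMk_left]
  rfl

variable [MeasurableSpace Ω] {μ : Measure Ω}

theorem IsSampled.ae_mem_labelSets (hS : S.IsSampled μ P) [IsProbabilityMeasure μ]
    [∀ v, IsProbabilityMeasure (P v)] : ∀ᵐ ω ∂μ, S.L ω ∈ S.labelSets (S.W ω) := by
  rw [ae_iff, measure_eq_sum_inter_preimage μ hS.measurable_W]
  refine Finset.sum_eq_zero fun w _ => ?_
  by_cases h0 : μ (S.W ⁻¹' {w}) = 0
  · exact measure_mono_null Set.inter_subset_right h0
  have hWm : MeasurableSet (S.W ⁻¹' {w}) := hS.measurable_W (measurableSet_singleton w)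
  have hYL : Measurable fun ω => (S.Y ω, S.L ω) := hS.measurable_Y.prodMk hS.measurable_L
  have hD : MeasurableSet ((Set.univ : Set (Fin S.n → 𝒴)) ×ˢ (S.labelSets w)ᶜ) :=
    MeasurableSet.univ.prod MeasurableSet.of_discrete
  have hev : {ω | ¬ S.L ω ∈ S.labelSets (S.W ω)} ∩ S.W ⁻¹' {w} =
      S.W ⁻¹' {w} ∩ (fun ω => (S.Y ω, S.L ω)) ⁻¹' (Set.univ ×ˢ (S.labelSets w)ᶜ) := by
    ext ω
    simp only [Set.mem_inter_iff, Set.mem_preimage, Set.mem_singleton_iff, Set.mem_prod,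
      Set.mem_ofPred_eq, Set.mem_univ, true_and, Set.mem_compl_iff]
    constructor
    · rintro ⟨h, rfl⟩; exact ⟨rfl, h⟩
    · rintro ⟨rfl, h⟩; exact ⟨h, rfl⟩
  rw [hev, ← cond_mul_eq_inter hWm, ← Measure.map_apply hYL hD, hS.law w h0, Measure.prod_prod,
    uniformOn, cond_apply MeasurableSet.of_discrete, Set.inter_compl_self]
  simp

/-- Group and label patterns of positive probability have the prescribed group sizes. -/
theorem IsSampled.isPattern (hS : S.IsSampled μ P) [IsProbabilityMeasure μ]
    [∀ v, IsProbabilityMeasure (P v)]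
    {p : ({i // i ∈ S.holdOut} → Bool) × ({i // i ∈ S.holdOut} → Bool)}
    (hp : μ (S.patternEvent p) ≠ 0) : IsPattern S.h S.l p.1 p.2 := by
  have hex : ∃ ω ∈ S.patternEvent p, (∀ v : Bool,
      (S.holdOut.filter fun i => S.W ω i = v).card = S.h v) ∧ S.L ω ∈ S.labelSets (S.W ω) := by
    by_contra! hcon
    refine hp (measure_mono_null (t := {ω | ¬ ((∀ v : Bool,
      (S.holdOut.filter fun i => S.W ω i = v).card = S.h v) ∧ S.L ω ∈ S.labelSets (S.W ω))})
      (fun ω hω hgood => hcon ω hω hgood.1 hgood.2) ?_)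
    exact ae_iff.1 (hS.card_holdOut.and hS.ae_mem_labelSets)
  obtain ⟨ω, ⟨hw, hs⟩, hcard, hsupp, hlab⟩ := hex
  refine ⟨fun v => ?_, fun v => ?_⟩
  · rw [← hcard v, ← hw, Finset.card_filter, Finset.card_filter,
      Finset.sum_coe_sort S.holdOut fun i => if S.W ω i = v then 1 else 0]
  · rw [← hlab v, ← hw, ← hs, Finset.card_filter, Finset.card_filter,
      Finset.sum_coe_sort S.holdOut fun i => if S.L ω i = true ∧ S.W ω i = v then 1 else 0]
    refine Finset.sum_subset (Finset.subset_univ _) fun i _ hi => if_neg fun h => ?_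
    exact hi (hsupp i h.1)

theorem IsSampled.sum_restrict_patternEvent (hS : S.IsSampled μ P) :
    Measure.sum (fun p => μ.restrict (S.patternEvent p)) = μ := by
  rw [← Measure.restrict_iUnion S.disjoint_patternEvent hS.measurableSet_patternEvent]
  have : (⋃ p, S.patternEvent p) = Set.univ :=
    Set.eq_univ_of_forall fun ω => Set.mem_iUnion.2 ⟨(_, _), rfl, rfl⟩
  rw [this, Measure.restrict_univ]

/-- Given the learned objects, the scaled error has the law that belongs to fixed score functions.
All patterns of positive probability have the same group sizes and hence the same error law, so any
one of them can be used to describe it. -/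
theorem IsSampled.condDistrib_scaledError (hS : S.IsSampled μ P) [IsProbabilityMeasure μ]
    [∀ v, IsProbabilityMeasure (P v)] (hf : Measurable (Function.uncurry f))
    (hg : Measurable (Function.uncurry g))
    (hSE : Measurable (S.scaledError P f g))
    {p : ({i // i ∈ S.holdOut} → Bool) × ({i // i ∈ S.holdOut} → Bool)}
    (hp : IsPattern S.h S.l p.1 p.2) :
    ∀ᵐ ω ∂μ, condDistrib (S.scaledError P f g) S.learned μ (S.learned ω) =
      errorLaw P S.h S.l (Real.sqrt ((min (S.l true) (S.l false) : ℕ) : ℝ)) (f (S.themes ω))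
        (g (S.scorer ω)) p.1 p.2 := by
  have hfx : ∀ θ, Measurable (f θ) := fun θ => hf.comp measurable_prodMk_left
  have hgx : ∀ ψ, Measurable (g ψ) := fun ψ => hg.comp measurable_prodMk_left
  have hLm := hS.measurable_learned
  have hK : IsMarkovKernel (S.errorKernel P f g p) :=
    ⟨fun x => by
      rw [errorKernel_apply hf hg]
      exact isProbabilityMeasure_errorLaw (hfx _) (hgx _) _⟩
  have hpart : ∀ q, (μ.restrict (S.patternEvent q)).map
      (fun ω => (S.learned ω, S.scaledError P f g ω)) =
      ((μ.restrict (S.patternEvent q)).map S.learned) ⊗ₘ S.errorKernel P f g p := by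
    intro q
    by_cases h0 : μ (S.patternEvent q) = 0
    · simp [Measure.restrict_eq_zero.2 h0]
    have hq := hS.isPattern h0
    have hm := measurable_patternError (S := S) (P := P) hf hg q
    have hm' : Measurable fun z => (z.1, S.patternError P f g q z) := measurable_fst.prodMk hm
    have h1 : (fun ω => (S.learned ω, S.scaledError P f g ω))
        =ᵐ[μ.restrict (S.patternEvent q)]
        (fun z => (z.1, S.patternError P f g q z)) ∘ fun ω => (S.learned ω, S.holdOutDocs ω) := by
      filter_upwards [ae_restrict_mem (hS.measurableSet_patternEvent q)] with ω hω
      simp only [Function.comp_apply]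
      rw [scaledError_eq_patternError hω]
    rw [Measure.map_congr h1, ← Measure.map_map hm' (hLm.prodMk hS.measurable_holdOutDocs),
      hS.map_learned_docs]
    ext D hD
    rw [Measure.map_apply hm' hD, Measure.prod_apply (hm' hD), Measure.compProd_apply hD]
    refine lintegral_congr fun x => ?_
    -- The law depends on the pattern only through the group sizes.
    rw [errorKernel_apply hf hg, errorLaw_eq_of_isPattern (hfx _) (hgx _) _ hp hq,
      ← errorKernel_apply hf hg, errorKernel, Kernel.map_apply _ hm, Kernel.prod_apply,
      Kernel.id_apply, Kernel.const_apply, Measure.dirac_prod,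
      Measure.map_map hm measurable_prodMk_left,
      Measure.map_apply (hm.comp measurable_prodMk_left) (measurable_prodMk_left hD)]
    rfl
  have hjoint : μ.map (fun ω => (S.learned ω, S.scaledError P f g ω)) =
      μ.map S.learned ⊗ₘ S.errorKernel P f g p := by
    conv_lhs => rw [← hS.sum_restrict_patternEvent]
    conv_rhs => rw [← hS.sum_restrict_patternEvent]
    rw [Measure.map_sum (hLm.prodMk hSE).aemeasurable, Measure.map_sum hLm.aemeasurable,
      Measure.compProd_sum_left]
    exact congrArg _ (funext hpart)
  have h := condDistrib_ae_eq_of_measure_eq_compProd S.learned hSE.aemeasurable hjoint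
  filter_upwards [ae_of_ae_map hLm.aemeasurable h] with ω hω
  rw [hω, errorKernel_apply hf hg]
  rfl

end HoldOutStudy

/-! ### Almost sure bounds on the learned score functions -/

/-- A lower bound on the variances of group `v` bounds the diagonal of the asymptotic variance, up
to the weight of the group. -/
theorem le_asympVar_diag {𝒴 : Type*} [MeasurableSpace 𝒴] {k : ℕ} {P : Bool → Measure 𝒴}
    [∀ v, IsProbabilityMeasure (P v)] {h l : Bool → ℕ} {a b : 𝒴 → Fin k → ℝ} {c ε ρ : ℝ}
    (ha : Measurable a) (hb : Measurable b) (hle : ∀ v, l v ≤ h v)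
    (hbd : ∀ v, ∀ᵐ y ∂P v, ∀ j, |a y j| ≤ c ∧ |b y j| ≤ c) (hε : 0 ≤ ε) {v : Bool}
    (hρ : ρ ≤ ((min (l true) (l false) : ℕ) : ℝ) / (l v : ℝ))
    (h1 : (scoreVar (P v) a - ε • (1 : Matrix (Fin k) (Fin k) ℝ)).PosSemidef)
    (h2 : (scoreVar (P v) (fun y => b y - a y)
      - ε • (1 : Matrix (Fin k) (Fin k) ℝ)).PosSemidef) (i : Fin k) :
    ρ * ε ≤ asympVar P h l a b i i := by
  have hd1 : ε ≤ scoreVar (P v) a i i := by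
    have := h1.diag_nonneg (i := i)
    simpa using this
  have hd2 : ε ≤ scoreVar (P v) (fun y => b y - a y) i i := by
    have := h2.diag_nonneg (i := i)
    simpa using this
  have hnonneg : ∀ v, 0 ≤ ((((min (l true) (l false) : ℕ) : ℝ) / (l v : ℝ)) •
      (((l v : ℝ) / (h v : ℝ)) • scoreVar (P v) a
        + (1 - (l v : ℝ) / (h v : ℝ)) • scoreVar (P v) (fun y => b y - a y))) i i := by
    intro v
    have hs1 := (posSemidef_scoreVar (Q := P v) (c := c) ha
      (by filter_upwards [hbd v] with y hy j using (hy j).1)).diag_nonneg (i := i)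
    have hs2 := (posSemidef_scoreVar (Q := P v) (s := fun y => b y - a y) (c := 2 * c)
      (hb.sub ha) (by
        filter_upwards [hbd v] with y hy j
        exact (abs_sub _ _).trans (by linarith [(hy j).1, (hy j).2]))).diag_nonneg (i := i)
    have : (l v : ℝ) / h v ≤ 1 :=
      div_le_one_of_le₀ (by exact_mod_cast hle v) (by positivity)
    have : 0 ≤ 1 - (l v : ℝ) / h v := by linarith
    simp only [Matrix.smul_apply, Matrix.add_apply, smul_eq_mul]
    positivity
  have hv : ρ * ε ≤ ((((min (l true) (l false) : ℕ) : ℝ) / (l v : ℝ)) •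
      (((l v : ℝ) / (h v : ℝ)) • scoreVar (P v) a
        + (1 - (l v : ℝ) / (h v : ℝ)) • scoreVar (P v) (fun y => b y - a y))) i i := by
    have hp0 : 0 ≤ (l v : ℝ) / h v := by positivity
    have hp1 : (l v : ℝ) / h v ≤ 1 :=
      div_le_one_of_le₀ (by exact_mod_cast hle v) (by positivity)
    simp only [Matrix.smul_apply, Matrix.add_apply, smul_eq_mul]
    refine mul_le_mul hρ ?_ hε (by positivity)
    nlinarith [mul_le_mul_of_nonneg_left hd1 hp0,
      mul_le_mul_of_nonneg_left hd2 (sub_nonneg.2 hp1)]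
  unfold asympVar
  refine hv.trans ?_
  rw [Matrix.sum_apply]
  exact Finset.single_le_sum (f := fun v => ((((min (l true) (l false) : ℕ) : ℝ) / (l v : ℝ)) •
      (((l v : ℝ) / (h v : ℝ)) • scoreVar (P v) a
        + (1 - (l v : ℝ) / (h v : ℝ)) • scoreVar (P v) (fun y => b y - a y))) i i)
    (fun v _ => hnonneg v) (Finset.mem_univ v)

namespace HoldOutStudy

variable {Ω 𝒴 Θ Ψ : Type*} {k : ℕ} [MeasurableSpace Ω] [MeasurableSpace 𝒴] [MeasurableSpace Θ]
  [MeasurableSpace Ψ] {S : HoldOutStudy Ω 𝒴 Θ Ψ} {μ : Measure Ω} {P : Bool → Measure 𝒴}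
  {f : Θ → 𝒴 → Fin k → ℝ} {g : Ψ → 𝒴 → Fin k → ℝ} {c : ℝ}

theorem IsSampled.exists_isPattern (hS : S.IsSampled μ P) [IsProbabilityMeasure μ]
    [∀ v, IsProbabilityMeasure (P v)] :
    ∃ p : ({i // i ∈ S.holdOut} → Bool) × ({i // i ∈ S.holdOut} → Bool),
      IsPattern S.h S.l p.1 p.2 := by
  by_contra! hcon
  have h0 : ∀ p, μ (S.patternEvent p) = 0 := fun p => by
    by_contra h
    exact hcon p (hS.isPattern h)
  have : μ = 0 := by
    rw [← hS.sum_restrict_patternEvent]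
    simp [Measure.restrict_eq_zero.2 (h0 _)]
  exact IsProbabilityMeasure.ne_zero μ this

/-- Since both groups occur in the hold-out sample, the bound on the scores of the hold-out units
bounds the learned score functions almost everywhere under both population distributions. -/
theorem IsSampled.ae_score_bound (hS : S.IsSampled μ P) [IsProbabilityMeasure μ]
    [∀ v, IsProbabilityMeasure (P v)] (hf : Measurable (Function.uncurry f))
    (hg : Measurable (Function.uncurry g))
    (hbdd : ∀ i ∈ S.holdOut, ∀ᵐ ω ∂μ, ∀ j,
      |S.trueScore f i ω j| ≤ c ∧ |S.machineScore g i ω j| ≤ c) :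
    ∀ᵐ ω ∂μ, ∀ v, ∀ᵐ y ∂P v, ∀ j, |f (S.themes ω) y j| ≤ c ∧ |g (S.scorer ω) y j| ≤ c := by
  have hLm := hS.measurable_learned
  have hset : MeasurableSet {z : (Θ × Ψ) × 𝒴 | ∀ j, |f z.1.1 z.2 j| ≤ c ∧ |g z.1.2 z.2 j| ≤ c} := by
    have h1 : Measurable fun z : (Θ × Ψ) × 𝒴 => f z.1.1 z.2 :=
      hf.comp ((measurable_fst.comp measurable_fst).prodMk measurable_snd)
    have h2 : Measurable fun z : (Θ × Ψ) × 𝒴 => g z.1.2 z.2 :=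
      hg.comp ((measurable_snd.comp measurable_fst).prodMk measurable_snd)
    simp only [Set.ofPred_forall]
    exact MeasurableSet.iInter fun j =>
      (measurableSet_le ((measurable_pi_apply j).comp h1).abs measurable_const).inter
        (measurableSet_le ((measurable_pi_apply j).comp h2).abs measurable_const)
  rw [← hS.sum_restrict_patternEvent, Measure.ae_sum_iff]
  intro p
  by_cases h0 : μ (S.patternEvent p) = 0
  · simp [Measure.restrict_eq_zero.2 h0]
  have hp := hS.isPattern h0
  rw [ae_all_iff]
  intro v
  obtain ⟨i, hi⟩ : ∃ i, p.1 i = v := by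
    have hcard : 0 < (Finset.univ.filter fun i => p.1 i = v).card := by
      rw [hp.card_group v]
      exact (hS.label_pos v).trans_le (hS.label_le v)
    obtain ⟨i, hi⟩ := Finset.card_pos.1 hcard
    exact ⟨i, (Finset.mem_filter.1 hi).2⟩
  have hset' : MeasurableSet {z : (Θ × Ψ) × ({i // i ∈ S.holdOut} → 𝒴) |
      ∀ j, |f z.1.1 (z.2 i) j| ≤ c ∧ |g z.1.2 (z.2 i) j| ≤ c} := by
    have hev : Measurable fun z : (Θ × Ψ) × ({i // i ∈ S.holdOut} → 𝒴) => (z.1, z.2 i) :=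
      measurable_fst.prodMk ((measurable_pi_apply i).comp measurable_snd)
    exact hev hset
  have h1 : ∀ᵐ z ∂(μ.restrict (S.patternEvent p)).map (fun ω => (S.learned ω, S.holdOutDocs ω)),
      ∀ j, |f z.1.1 (z.2 i) j| ≤ c ∧ |g z.1.2 (z.2 i) j| ≤ c := by
    rw [ae_map_iff (hLm.prodMk hS.measurable_holdOutDocs).aemeasurable hset']
    exact ae_restrict_of_ae (hbdd i i.2)
  rw [hS.map_learned_docs] at h1
  filter_upwards [ae_of_ae_map hLm.aemeasurable (Measure.ae_ae_of_ae_prod h1)] with ω hω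
  have hmp := measurePreserving_eval (fun i : {i // i ∈ S.holdOut} => P (p.1 i)) i
  rw [← hi, ← hmp.map_eq]
  have hset₂ : MeasurableSet {y : 𝒴 | ∀ j, |f (S.themes ω) y j| ≤ c ∧ |g (S.scorer ω) y j| ≤ c} :=
    measurable_prodMk_left (x := S.learned ω) hset
  exact (ae_map_iff hmp.measurable.aemeasurable hset₂).2 hω

theorem IsSampled.measurable_unit_contribution (hS : S.IsSampled μ P) (hf : Measurable (Function.uncurry f))
    (hg : Measurable (Function.uncurry g)) (i : Fin S.n) :
    Measurable fun ω => contribution S.h S.l (f (S.themes ω)) (g (S.scorer ω)) (S.W ω i) (S.L ω i)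
      (S.Y ω i) := by
  have hY : Measurable fun ω => S.Y ω i := (measurable_pi_apply i).comp hS.measurable_Y
  have hW : Measurable fun ω => S.W ω i := (measurable_pi_apply i).comp hS.measurable_W
  have hL : Measurable fun ω => S.L ω i := (measurable_pi_apply i).comp hS.measurable_L
  have hF : Measurable fun ω => f (S.themes ω) (S.Y ω i) :=
    hf.comp (hS.measurable_themes.prodMk hY)
  have hG : Measurable fun ω => g (S.scorer ω) (S.Y ω i) :=
    hg.comp (hS.measurable_scorer.prodMk hY)
  refine measurable_pi_lambda _ fun j => ?_
  have hFj : Measurable fun ω => f (S.themes ω) (S.Y ω i) j := (measurable_pi_apply j).comp hF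
  have hGj : Measurable fun ω => g (S.scorer ω) (S.Y ω i) j := (measurable_pi_apply j).comp hG
  have hWφ : ∀ φ : Bool → ℝ, Measurable fun ω => φ (S.W ω i) := fun φ =>
    Measurable.of_discrete.comp hW
  exact (hWφ fun v => if v then 1 else -1).mul ((hGj.div (hWφ fun v => (S.h v : ℝ))).sub
    (Measurable.ite (hL (measurableSet_singleton true))
      ((hGj.sub hFj).div (hWφ fun v => (S.l v : ℝ))) measurable_const))

theorem IsSampled.integrable_tauHat (hS : S.IsSampled μ P) [IsProbabilityMeasure μ]
    (hf : Measurable (Function.uncurry f)) (hg : Measurable (Function.uncurry g)) (hc : 0 ≤ c)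
    (hbdd : ∀ i ∈ S.holdOut, ∀ᵐ ω ∂μ, ∀ j,
      |S.trueScore f i ω j| ≤ c ∧ |S.machineScore g i ω j| ≤ c) :
    Integrable (S.tauHat f g) μ := by
  have he : S.tauHat f g = fun ω => ∑ i : {i // i ∈ S.holdOut}, contribution S.h S.l
      (f (S.themes ω)) (g (S.scorer ω)) (S.W ω i) (S.L ω i) (S.Y ω i) :=
    funext fun ω => S.tauHat_eq_sum_contribution f g ω
  rw [he]
  refine integrable_finsetSum _ fun i _ => Integrable.of_bound
    (hS.measurable_unit_contribution hf hg i).aestronglyMeasurable (3 * c) ?_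
  filter_upwards [hbdd i i.2] with ω hω
  refine (pi_norm_le_iff_of_nonneg (by positivity)).2 fun j => ?_
  refine (abs_contribution_le (hS.label_pos _) (hS.label_le _) _ (hω j).1 (hω j).2).trans ?_
  refine div_le_self (by positivity) ?_
  exact_mod_cast hS.label_pos _

/-! ### Unbiasedness and asymptotic normality -/

theorem integral_errorLaw {𝒴 : Type*} [MeasurableSpace 𝒴] {P : Bool → Measure 𝒴}
    [∀ v, IsProbabilityMeasure (P v)] {h l : Bool → ℕ} {a b : 𝒴 → Fin k → ℝ} {c : ℝ}
    (ha : Measurable a) (hb : Measurable b) (hl : ∀ v, 0 < l v)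
    (hle : ∀ v, l v ≤ h v) (hbd : ∀ v, ∀ᵐ y ∂P v, ∀ j, |a y j| ≤ c ∧ |b y j| ≤ c)
    {ι : Type*} [Fintype ι] {w s : ι → Bool} (hp : IsPattern h l w s) (r : ℝ) :
    ∫ x, x ∂errorLaw P h l r a b w s = 0 := by
  have hcm : ∀ v t, Measurable (contribution h l a b v t) := measurable_contribution h l ha hb
  have hci : ∀ v t j, Integrable (fun y => contribution h l a b v t y j) (P v) := fun v t j =>
    memLp_one_iff_integrable.1
      (memLp_coord_of_bound (hcm v t) (ae_abs_contribution_le hl hle hbd v t) j 1)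
  have hci' : ∀ v t, Integrable (contribution h l a b v t) (P v) := fun v t =>
    Integrable.of_eval (hci v t)
  have hpi : ∀ i : ι, Integrable (fun y : ι → 𝒴 => contribution h l a b (w i) (s i) (y i))
      (Measure.pi fun i => P (w i)) := fun i =>
    (measurePreserving_eval (fun i => P (w i)) i).integrable_comp_of_integrable (hci' _ _)
  rw [errorLaw, integral_map (measurable_sum_contribution ha hb r _ w s).aemeasurable
    (f := fun x => x) aestronglyMeasurable_id, integral_smul, integral_sub (integrable_finsetSum _ fun i _ => hpi i)
    (integrable_const _), integral_finsetSum _ fun i _ => hpi i]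
  have : ∑ i, ∫ y : ι → 𝒴, contribution h l a b (w i) (s i) (y i) ∂(Measure.pi fun i => P (w i)) =
      scoreMean (P true) a - scoreMean (P false) a := by
    funext j
    rw [← sum_integral_contribution ha hb hl hle hbd hp j, Finset.sum_apply]
    refine Finset.sum_congr rfl fun i _ => ?_
    rw [integral_comp_eval (hcm (w i) (s i)).aestronglyMeasurable, eval_integral (hci _ _)]
  rw [this]
  simp

theorem IsSampled.measurable_scaledError (hS : S.IsSampled μ P)
    [∀ v, IsProbabilityMeasure (P v)] (hf : Measurable (Function.uncurry f))
    (hg : Measurable (Function.uncurry g)) : Measurable (S.scaledError P f g) := by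
  have he : S.tauHat f g = fun ω => ∑ i : {i // i ∈ S.holdOut}, contribution S.h S.l
      (f (S.themes ω)) (g (S.scorer ω)) (S.W ω i) (S.L ω i) (S.Y ω i) :=
    funext fun ω => S.tauHat_eq_sum_contribution f g ω
  have h1 : Measurable (S.tauHat f g) := by
    rw [he]
    exact Finset.measurable_fun_sum _ fun i _ => hS.measurable_unit_contribution hf hg i
  have h2 : Measurable (S.tau P f) :=
    ((measurable_scoreMean hf).comp hS.measurable_themes).sub
      ((measurable_scoreMean hf).comp hS.measurable_themes)
  exact (h1.sub h2).const_smul (Real.sqrt (S.lmin : ℝ))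

theorem IsSampled.condExp_tauHat (hS : S.IsSampled μ P) [IsProbabilityMeasure μ]
    [∀ v, IsProbabilityMeasure (P v)] (hf : Measurable (Function.uncurry f))
    (hg : Measurable (Function.uncurry g)) (hc : 0 ≤ c)
    (hbdd : ∀ i ∈ S.holdOut, ∀ᵐ ω ∂μ, ∀ j,
      |S.trueScore f i ω j| ≤ c ∧ |S.machineScore g i ω j| ≤ c) :
    μ[S.tauHat f g | MeasurableSpace.comap S.learned inferInstance] =ᵐ[μ] S.tau P f := by
  have hm : MeasurableSpace.comap S.learned inferInstance ≤ (inferInstance : MeasurableSpace Ω) :=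
    hS.measurable_learned.comap_le
  have hfx : ∀ θ, Measurable (f θ) := fun θ => hf.comp measurable_prodMk_left
  have hgx : ∀ ψ, Measurable (g ψ) := fun ψ => hg.comp measurable_prodMk_left
  have hbound := hS.ae_score_bound hf hg hbdd
  have hSE := hS.measurable_scaledError hf hg
  have hi := hS.integrable_tauHat hf hg hc hbdd
  set r : ℝ := Real.sqrt (S.lmin : ℝ) with hr
  have hr0 : r ≠ 0 := (Real.sqrt_pos.2 (Nat.cast_pos.2
    (lt_min (hS.label_pos true) (hS.label_pos false)))).ne'
  have htm : Measurable fun x : Θ × Ψ => scoreMean (P true) (f x.1) - scoreMean (P false) (f x.1) :=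
    ((measurable_scoreMean hf).comp measurable_fst).sub
      ((measurable_scoreMean hf).comp measurable_fst)
  have hts : StronglyMeasurable[MeasurableSpace.comap S.learned inferInstance] (S.tau P f) :=
    htm.stronglyMeasurable.comp_measurable (comap_measurable S.learned)
  have hti : Integrable (S.tau P f) μ := by
    refine Integrable.of_bound (hts.mono hm).aestronglyMeasurable (2 * c) ?_
    filter_upwards [hbound] with ω hω
    refine (pi_norm_le_iff_of_nonneg (by positivity)).2 fun j => ?_
    have hmean : ∀ v, |∫ y, f (S.themes ω) y j ∂P v| ≤ c := fun v => by
      have := norm_integral_le_of_norm_le_const (μ := P v) (C := c)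
        (f := fun y => f (S.themes ω) y j) (by filter_upwards [hω v] with y hy using (hy j).1)
      rwa [probReal_univ, mul_one] at this
    exact (abs_sub _ _).trans ((add_le_add (hmean true) (hmean false)).trans (two_mul c).ge)
  have hSEi : Integrable (S.scaledError P f g) μ := (hi.sub hti).smul r
  have hdecomp : S.tauHat f g = S.tau P f + r⁻¹ • S.scaledError P f g := by
    funext ω
    simp only [Pi.add_apply, Pi.smul_apply, scaledError]
    rw [smul_smul, inv_mul_cancel₀ hr0, one_smul, add_sub_cancel]
  obtain ⟨p, hp⟩ := hS.exists_isPattern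
  have hzero : μ[S.scaledError P f g | MeasurableSpace.comap S.learned inferInstance]
      =ᵐ[μ] fun _ => 0 := by
    filter_upwards [condExp_ae_eq_integral_condDistrib' hS.measurable_learned hSEi,
      hS.condDistrib_scaledError hf hg hSE hp, hbound] with ω h1 h2 h3
    rw [h1, h2]
    exact integral_errorLaw (hfx _) (hgx _) hS.label_pos hS.label_le h3 hp _
  have h1 : μ[S.tauHat f g | MeasurableSpace.comap S.learned inferInstance] =ᵐ[μ]
      μ[S.tau P f | MeasurableSpace.comap S.learned inferInstance]
        + μ[r⁻¹ • S.scaledError P f g | MeasurableSpace.comap S.learned inferInstance] := by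
    rw [hdecomp]
    exact condExp_add hti (hSEi.smul _) _
  filter_upwards [h1, condExp_smul (μ := μ) r⁻¹ (S.scaledError P f g)
    (MeasurableSpace.comap S.learned inferInstance), hzero] with ω e1 e2 e3
  rw [e1, Pi.add_apply, e2, Pi.smul_apply, e3, smul_zero, add_zero,
    condExp_of_stronglyMeasurable hm hts hti]

/-- The distribution function gap is at most `δ` once enough units are labeled; the number of
labeled units needed depends only on the bound `c` on the scores and on the lower bound `e` for the
diagonal of the asymptotic variance. -/
theorem exists_cdfGap_le {𝒴 : Type*} [MeasurableSpace 𝒴] (P : Bool → Measure 𝒴)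
    [∀ v, IsProbabilityMeasure (P v)] (k : ℕ) {c e δ : ℝ} (hc : 0 ≤ c) (he : 0 < e) (hδ : 0 < δ) :
    ∃ N : ℕ, ∀ {Ω : Type*} {Θ Ψ : Type*} [MeasurableSpace Ω] [MeasurableSpace Θ]
      [MeasurableSpace Ψ] (S : HoldOutStudy Ω 𝒴 Θ Ψ) (μ : Measure Ω) [IsProbabilityMeasure μ]
      (f : Θ → 𝒴 → Fin k → ℝ) (g : Ψ → 𝒴 → Fin k → ℝ), S.IsSampled μ P →
      Measurable (Function.uncurry f) → Measurable (Function.uncurry g) →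
      (∀ i ∈ S.holdOut, ∀ᵐ ω ∂μ, ∀ j,
        |S.trueScore f i ω j| ≤ c ∧ |S.machineScore g i ω j| ≤ c) →
      (∀ᵐ ω ∂μ, ∀ i, e ≤ S.sigma P f g ω i i) → N ≤ S.lmin →
      ∀ᵐ ω ∂μ, S.cdfGap μ P f g ω ≤ δ := by
  obtain ⟨N, hN⟩ := exists_errorLaw_orthant_close P k hc he hδ
  refine ⟨N, fun S μ _ f g hS hf hg hbdd hdiag hmin => ?_⟩
  have hfx : ∀ θ, Measurable (f θ) := fun θ => hf.comp measurable_prodMk_left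
  have hgx : ∀ ψ, Measurable (g ψ) := fun ψ => hg.comp measurable_prodMk_left
  obtain ⟨p, hp⟩ := hS.exists_isPattern
  filter_upwards [hS.ae_score_bound hf hg hbdd, hdiag,
    hS.condDistrib_scaledError hf hg (hS.measurable_scaledError hf hg) hp] with ω h1 h2 h3
  refine ciSup_le fun t => ?_
  rw [h3, sigma_eq_asympVar]
  refine hN S.h S.l _ _ _ p.1 p.2 (hfx _) (hgx _) hS.label_pos hS.label_le h1 hp ?_ hmin t
  rwa [sigma_eq_asympVar] at h2

/-- If the variances of group `v` are bounded below by `ε` and the group has at most `1 / ρ` times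
as many labeled units as the smaller group, then the diagonal of `Σ†` is at least `ρ ε`. -/
theorem IsSampled.le_sigma_diag (hS : S.IsSampled μ P) [IsProbabilityMeasure μ]
    [∀ v, IsProbabilityMeasure (P v)] (hf : Measurable (Function.uncurry f))
    (hg : Measurable (Function.uncurry g))
    (hbdd : ∀ i ∈ S.holdOut, ∀ᵐ ω ∂μ, ∀ j,
      |S.trueScore f i ω j| ≤ c ∧ |S.machineScore g i ω j| ≤ c)
    {ε ρ : ℝ} (hε : 0 ≤ ε) {v : Bool} (hvar : S.VarBoundedBelow μ P f g ε v)
    (hρ : ρ ≤ (S.lmin : ℝ) / (S.l v : ℝ)) :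
    ∀ᵐ ω ∂μ, ∀ i, ρ * ε ≤ S.sigma P f g ω i i := by
  filter_upwards [hS.ae_score_bound hf hg hbdd, hvar] with ω h1 h2 i
  rw [sigma_eq_asympVar]
  exact le_asympVar_diag (hf.comp measurable_prodMk_left) (hg.comp measurable_prodMk_left)
    hS.label_le h1 hε hρ h2.1 h2.2 i

end HoldOutStudy

/-- Valid inference with combined scores: the prediction-powered estimator is conditionally
unbiased, and conditionally asymptotically normal uniformly over lower orthants. -/
theorem proposition3 {𝒴 Θ Ψ : Type*} [MeasurableSpace 𝒴] [MeasurableSpace Θ] [MeasurableSpace Ψ]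
    {k : ℕ}
    (P : Bool → Measure 𝒴) [∀ w, IsProbabilityMeasure (P w)]
    (f : Θ → 𝒴 → Fin k → ℝ) (hf : Measurable (Function.uncurry f))
    (g : Ψ → 𝒴 → Fin k → ℝ) (hg : Measurable (Function.uncurry g))
    {Ω : ℕ → Type*} [∀ m, MeasurableSpace (Ω m)]
    (μ : ∀ m, Measure (Ω m)) [∀ m, IsProbabilityMeasure (μ m)]
    (S : ∀ m, HoldOutStudy (Ω m) 𝒴 Θ Ψ) (hS : ∀ m, (S m).IsSampled (μ m) P)
    (c ε : ℝ) (hε : 0 < ε)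
    (hbdd : ∀ m, ∀ i ∈ (S m).holdOut, ∀ᵐ ω ∂(μ m), ∀ j,
      |(S m).trueScore f i ω j| ≤ c ∧ |(S m).machineScore g i ω j| ≤ c)
    (hvar : ∀ m, (S m).VarBoundedBelow (μ m) P f g ε true) :
    (∀ m, Integrable ((S m).tauHat f g) (μ m) ∧
      (μ m)[(S m).tauHat f g | MeasurableSpace.comap (S m).learned inferInstance]
        =ᵐ[μ m] (S m).tau P f) ∧
    (Tendsto (fun m => (S m).lmin) atTop atTop →
      ((∀ m, (S m).VarBoundedBelow (μ m) P f g ε false) ∨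
        (∃ C : ℝ, ∀ m, ((S m).l true : ℝ) ≤ C * ((S m).l false : ℝ))) →
      ∀ δ : ℝ, 0 < δ →
        Tendsto (fun m => (μ m) {ω | δ ≤ (S m).cdfGap (μ m) P f g ω}) atTop (𝓝 0)) := by
  -- With no constraint on the sign of `c`, replace it by `|c|`.
  have hc : 0 ≤ |c| := abs_nonneg c
  have hbdd' : ∀ m, ∀ i ∈ (S m).holdOut, ∀ᵐ ω ∂(μ m), ∀ j,
      |(S m).trueScore f i ω j| ≤ |c| ∧ |(S m).machineScore g i ω j| ≤ |c| := by
    intro m i hi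
    filter_upwards [hbdd m i hi] with ω hω j
    exact ⟨(hω j).1.trans (le_abs_self c), (hω j).2.trans (le_abs_self c)⟩
  refine ⟨fun m => ⟨(hS m).integrable_tauHat hf hg hc (hbdd' m),
    (hS m).condExp_tauHat hf hg hc (hbdd' m)⟩, fun hlim hcase δ hδ => ?_⟩
  obtain ⟨e, he, hdiag⟩ : ∃ e : ℝ, 0 < e ∧
      ∀ m, ∀ᵐ ω ∂(μ m), ∀ i, e ≤ (S m).sigma P f g ω i i := by
    rcases hcase with hfalse | ⟨C, hC⟩
    · -- The group with fewer labeled units has weight one.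
      refine ⟨1 * ε, by linarith, fun m => ?_⟩
      obtain ⟨v, hv⟩ : ∃ v, (S m).lmin = (S m).l v := by
        rcases min_choice ((S m).l true) ((S m).l false) with h | h
        exacts [⟨true, h⟩, ⟨false, h⟩]
      have hlv : ((S m).l v : ℝ) ≠ 0 := Nat.cast_ne_zero.2 ((hS m).label_pos v).ne'
      refine (hS m).le_sigma_diag hf hg (hbdd' m) hε.le (v := v) ?_ (by rw [hv, div_self hlv])
      cases v
      exacts [hfalse m, hvar m]
    · have hM : 0 < max 1 C := lt_of_lt_of_le one_pos (le_max_left _ _)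
      refine ⟨1 / max 1 C * ε, by positivity, fun m => ?_⟩
      refine (hS m).le_sigma_diag hf hg (hbdd' m) hε.le (hvar m) ?_
      have hl1 : (0 : ℝ) < (S m).l true := Nat.cast_pos.2 ((hS m).label_pos true)
      rw [div_le_div_iff₀ hM hl1, one_mul]
      rcases min_choice ((S m).l true) ((S m).l false) with h | h
      · rw [HoldOutStudy.lmin, h]
        exact le_mul_of_one_le_right hl1.le (le_max_left _ _)
      · rw [HoldOutStudy.lmin, h, mul_comm]
        exact (hC m).trans (mul_le_mul_of_nonneg_right (le_max_right _ _) (Nat.cast_nonneg _))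
  obtain ⟨N, hN⟩ := HoldOutStudy.exists_cdfGap_le P k hc he (half_pos hδ)
  refine tendsto_const_nhds.congr' ?_
  filter_upwards [hlim.eventually_ge_atTop N] with m hm
  refine (measure_mono_null (fun ω hω hle => ?_)
    (ae_iff.1 (hN (S m) (μ m) f g (hS m) hf hg (hbdd' m) (hdiag m) hm))).symm
  have hω' : δ ≤ (S m).cdfGap (μ m) P f g ω := hω
  linarith
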